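/- Let $\mathfrak g$ be a finite-dimensional simple complex Lie algebra with Cartan subalgebra $\mathfrak h$, set of roots $R$, simple roots $\alpha_i$ ($i\in I$), positive roots $R^+$, coroots $h_\alpha$, fundamental weights $\omega_i$, and monoid $P^+$ of dominant integral weights. Let $R'\subseteq R$ be closed under negation and under addition (if $\alpha,\beta\in R'$ and $\alpha+\beta\in R$, then $\alpha+\beta\in R'$), and let $\mathfrak a$ be the (semisimple) Lie subalgebra of $\mathfrak g$ generated by the root spaces $\mathfrak g_\alpha$, $\alpha\in R'$, with Cartan subalgebra $\mathfrak h_{\mathfrak a}=\sum_{\alpha\in R'}[\mathfrak g_\alpha,\mathfrak g_{-\alpha}]\subseteq\mathfrak h$ and positive roots $R'\cap R^+$; its fundamental weights are $\tau_j$ ($j\in J$), and $P^+_{\mathfrak a}$ is its monoid of dominant integral weights. Restriction of functionals to $\mathfrak h_{\mathfrak a}$ gives $\pi:\mathfrak h^*\to\mathfrak h_{\mathfrak a}^*$ and $\pi:P^+\to P^+_{\mathfrak a}$. For $\lambda=\sum_i m_i\omega_i\in P^+$, the pair $(\mathfrak a,\lambda)$ is called globally admissible if for every $i$ with $m_i\neq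 0$ the weight $\pi(\omega_i)$ is either $0$ or one of the fundamental weights $\tau_j$ of $\mathfrak a$. Let $\mathcal E^\lambda$ be the set of finitely supported functions $\psi:\mathbb C\to P^+$ with $\sum_{c}\psi(c)=\lambda$, define $\mathcal E_{\mathfrak a}^{\mu}$ for $\mu\in P^+_{\mathfrak a}$ in the same way with $P^+_{\mathfrak a}$ in place of $P^+$, and let $\pi:\mathcal E^\lambda\to\mathcal E_{\mathfrak a}^{\pi(\lambda)}$ be $\psi\mapsto\pi\circ\psi$. For $\psi\in\mathcal E^\lambda$ let $V(\psi)=\bigotimes_{c\in\operatorname{supp}\psi}\operatorname{ev}_c V(\psi(c))$, where $V(\mu)$ is the simple finite-dimensional $\mathfrak g$-module of highest weight $\mu$ and $x\otimes p\in\mathfrak g\otimes\mathbb C[t]$ acts on the factor $\operatorname{ev}_cV(\psi(c))$ as $p(c)x$; let $v_\psi$ be the tensor product of highest weight vectors of the factors. Define the $\mathfrak a\otimes\mathbb C[t]$-module $V^{\mathfrak a}(\phi)$ for $\phi\in\mathcal E_{\mathfrak a}^{\mu}$ analogously. Then, for every $\lambda\in P^+$: (1) If $(\mathfrak a,\lambda)$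 is globally admissible, then for every $\phi\in\mathcal E_{\mathfrak a}^{\pi(\lambda)}$ there exists $\psi\in\mathcal E^\lambda$ such that $\pi\circ\psi=\phi$ and $V^{\mathfrak a}(\phi)\cong U(\mathfrak a\otimes\mathbb C[t]).v_\psi$ as $\mathfrak a\otimes\mathbb C[t]$-modules, where $U(\mathfrak a\otimes\mathbb C[t]).v_\psi\subseteq V(\psi)$. (2) $(\mathfrak a,\lambda)$ is globally admissible if and only if $\pi:\mathcal E^\lambda\to\mathcal E_{\mathfrak a}^{\pi(\lambda)}$ is surjective. -/

import Mathlib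

open scoped TensorProduct Polynomial
open Module LieAlgebra LieAlgebra.IsKilling

noncomputable section

namespace LeviCurrent

/-! ## Positive coroots -/

section Coroots

variable {ι M N : Type*} [AddCommGroup M] [Module ℂ M] [AddCommGroup N] [Module ℂ N]
  {P : RootPairing ι ℂ M N} [P.IsRootSystem]

/-- Helper fact: elements of the additive monoid generated by the simple coroots have coordinates
in `ℕ` with respect to the simple coroots. -/
theorem repr_nat_of_mem_closure (b : P.Base) {x : N}
    (hx : x ∈ AddSubmonoid.closure (P.coroot '' b.support)) (l : b.support) :
    ∃ n : ℕ, b.toCoweightBasis.repr x l = n := by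
  classical
  induction hx using AddSubmonoid.closure_induction with
  | mem x hx =>
    obtain ⟨j, hj, rfl⟩ := hx
    have := b.toCoweightBasis_repr_coroot ⟨j, hj⟩
    simp only at this
    rw [this, Finsupp.single_apply]
    split_ifs
    · exact ⟨1, by simp⟩
    · exact ⟨0, by simp⟩
  | zero => exact ⟨0, by simp⟩
  | add x y _ _ hx hy =>
    obtain ⟨m, hm⟩ := hx
    obtain ⟨n, hn⟩ := hy
    exact ⟨m + n, by simp [hm, hn]⟩

/-- Helper fact: the coroot of a positive root is a sum of simple coroots. -/
theorem coroot_mem_closure_of_isPos [Finite ι] [P.IsCrystallographic] [P.IsReduced]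
    (b : P.Base) {i : ι} (hi : b.IsPos i) :
    P.coroot i ∈ AddSubmonoid.closure (P.coroot '' b.support) := by
  classical
  suffices h : b.IsPos i → P.coroot i ∈ AddSubmonoid.closure (P.coroot '' b.support) from h hi
  refine hi.induction_on_reflect
    (p := fun i ↦ b.IsPos i → P.coroot i ∈ AddSubmonoid.closure (P.coroot '' b.support))
    (fun j hj _ ↦ AddSubmonoid.subset_closure ⟨j, hj, rfl⟩) ?_
  intro i j hp hj hk
  rcases (b.coroot_mem_or_neg_mem (P.reflectionPerm j i)) with h | h
  · exact h
  exfalso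
  let := P.indexNeg
  have hneg : ∀ k : ι, P.root (-k) = -P.root k := by
    intro k
    rw [RootPairing.indexNeg_neg, RootPairing.root_reflectionPerm,
      RootPairing.reflection_apply_self]
  by_cases hij : i = j
  · subst hij
    have := (RootPairing.Base.IsPos.neg_iff_not b i).mp hk
    exact this (RootPairing.Base.isPos_of_mem_support hj)
  by_cases hpos : b.IsPos i
  · have hi' := hp hpos
    have hcor : P.coroot (P.reflectionPerm j i) = P.coroot i - P.pairing j i • P.coroot j := by
      rw [RootPairing.coroot_reflectionPerm, RootPairing.coreflection_apply_coroot]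
    have hzero : ∀ l : b.support, l ≠ ⟨j, hj⟩ → b.toCoweightBasis.repr (P.coroot i) l = 0 := by
      intro l hl
      obtain ⟨m, hm⟩ := repr_nat_of_mem_closure b hi' l
      obtain ⟨n, hn⟩ := repr_nat_of_mem_closure b h l
      have hjl : b.toCoweightBasis.repr (P.coroot j) l = 0 := by
        have := b.toCoweightBasis_repr_coroot ⟨j, hj⟩
        simp only at this
        rw [this, Finsupp.single_apply, if_neg (Ne.symm hl)]
      rw [hcor] at hn
      simp [hjl, hm] at hn
      have h0 : ((m + n : ℕ) : ℂ) = 0 := by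
        push_cast
        rw [← hn]; ring
      have h1 : m + n = 0 := by exact_mod_cast h0
      rw [hm]
      have : m = 0 := by omega
      simp [this]
    have hmul : P.coroot i = (b.toCoweightBasis.repr (P.coroot i) ⟨j, hj⟩) • P.coroot j := by
      conv_lhs => rw [← b.toCoweightBasis.sum_repr (P.coroot i)]
      rw [Finset.sum_eq_single ⟨j, hj⟩]
      · simp
      · intro l _ hl
        rw [hzero l hl, zero_smul]
      · simp
    have hdep : ¬ LinearIndependent ℂ ![P.coroot i, P.coroot j] := by
      intro hli
      rw [LinearIndependent.pair_iff] at hli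
      have := hli (1 : ℂ) (-(b.toCoweightBasis.repr (P.coroot i) ⟨j, hj⟩))
        (by rw [one_smul, neg_smul, ← hmul, add_neg_cancel])
      exact one_ne_zero this.1
    rcases RootPairing.IsReduced.eq_or_eq_neg (P := P.flip) i j hdep with h' | h'
    · exact hij (P.flip.root.injective h')
    · have h2 : i = -j := by
        apply P.coroot.injective
        rw [RootPairing.indexNeg_neg, RootPairing.coroot_reflectionPerm,
          RootPairing.coreflection_apply_self]
        exact h'
      rw [h2] at hpos
      exact (RootPairing.Base.IsPos.neg_iff_not b j).mp hpos
        (RootPairing.Base.isPos_of_mem_support hj)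
  · have := (RootPairing.Base.isPos_of_mem_support hj)
    rcases RootPairing.Base.IsPos.or_neg b i with h1 | h1
    · exact hpos h1
    · by_cases hnij : -i = j
      · have h3 : P.reflectionPerm j i = j := by
          apply P.root.injective
          have h6 : P.root i = -P.root j := by rw [← hnij, hneg, neg_neg]
          rw [RootPairing.root_reflectionPerm, h6, map_neg, RootPairing.reflection_apply_self,
            neg_neg]
        rw [h3] at h
        obtain ⟨n, hn⟩ := repr_nat_of_mem_closure b h ⟨j, hj⟩
        have := b.toCoweightBasis_repr_coroot ⟨j, hj⟩
        simp only at this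
        simp [this] at hn
        have h0 : ((1 + n : ℕ) : ℂ) = 0 := by
          push_cast
          rw [← hn]; ring
        have h1 : 1 + n = 0 := by exact_mod_cast h0
        omega
      · have h4 := h1.reflectionPerm hj hnij
        have h5 : P.reflectionPerm j (-i) = -(P.reflectionPerm j i) := by
          apply P.root.injective
          rw [hneg, RootPairing.root_reflectionPerm, RootPairing.root_reflectionPerm, hneg, map_neg]
        rw [h5] at h4
        exact (RootPairing.Base.IsPos.neg_iff_not b _).mp h4 hk

end Coroots

/-! ## Weights of a simple Lie algebra -/

section Weights

variable {𝔤 : Type*} [LieRing 𝔤] [LieAlgebra ℂ 𝔤] [FiniteDimensional ℂ 𝔤] [LieAlgebra.IsSimple ℂ 𝔤]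
  {H : LieSubalgebra ℂ 𝔤} [H.IsCartanSubalgebra]

/-- The monoid `P⁺` of dominant integral weights: the functionals on `𝔥` whose values at all simple
coroots are natural numbers. -/
def dominantWeights (b : (rootSystem H).Base) : AddSubmonoid (Dual ℂ H) where
  carrier := {μ | ∀ i ∈ b.support, ∃ m : ℕ, μ ((rootSystem H).coroot i) = m}
  zero_mem' := fun _ _ ↦ ⟨0, by simp⟩
  add_mem' := by
    intro μ ν hμ hν i hi
    obtain ⟨m, hm⟩ := hμ i hi
    obtain ⟨n, hn⟩ := hν i hi
    exact ⟨m + n, by rw [LinearMap.add_apply, hm, hn, Nat.cast_add]⟩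

/-- The fundamental weight `ω_i`: the element dual to the simple coroot `h_{α_i}` in the basis of
`𝔥*` dual to the basis of simple coroots. -/
def fundamentalWeight (b : (rootSystem H).Base) (i : b.support) : Dual ℂ H :=
  b.toCoweightBasis.coord i

/-- The nilpotent subalgebra `𝔫⁺` (as a subspace), the sum of the root spaces of positive roots. -/
def nPos (b : (rootSystem H).Base) : Submodule ℂ 𝔤 :=
  ⨆ α : {α : H.root // b.IsPos α}, (rootSpace H (α : H.root).1).toSubmodule

end Weights

/-! ## Levi subalgebras -/

section Levi

variable {𝔤 : Type*} [LieRing 𝔤] [LieAlgebra ℂ 𝔤] [FiniteDimensional ℂ 𝔤] [LieAlgebra.IsSimple ℂ 𝔤]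
  (H : LieSubalgebra ℂ 𝔤) [H.IsCartanSubalgebra]

/-- A set `R'` of roots closed under addition (inside the set of roots) and under negation. -/
structure ClosedRootSet where
  /-- the roots in `R'` -/
  roots : Set H.root
  neg_mem : ∀ α ∈ roots, ∀ β : H.root,
    (rootSystem H).root β = -(rootSystem H).root α → β ∈ roots
  add_mem : ∀ α ∈ roots, ∀ β ∈ roots, ∀ γ : H.root,
    (rootSystem H).root γ = (rootSystem H).root α + (rootSystem H).root β → γ ∈ roots

variable {H}

/-- The Levi subalgebra `𝔞` of `𝔤`: the Lie subalgebra generated by the root spaces `𝔤_α`,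
`α ∈ R'`. -/
def levi (R' : ClosedRootSet H) : LieSubalgebra ℂ 𝔤 :=
  LieSubalgebra.lieSpan ℂ 𝔤 (⋃ α ∈ R'.roots, (rootSpace H α.1 : Set 𝔤))

/-- The Cartan subalgebra `𝔥_𝔞 = ∑_{α ∈ R'} [𝔤_α, 𝔤_{-α}]` of `𝔞`, that is the span of the coroots
`h_α`, `α ∈ R'`, as a subspace of `𝔥`. -/
def leviCartan (R' : ClosedRootSet H) : Submodule ℂ H :=
  Submodule.span ℂ ((rootSystem H).coroot '' R'.roots)

/-- Helper fact: `𝔥_𝔞 ⊆ 𝔞`. -/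
theorem leviCartan_le (R' : ClosedRootSet H) {h : H} (hh : h ∈ leviCartan R') :
    (h : 𝔤) ∈ levi R' := by
  have hsub : leviCartan R' ≤ (levi R').toSubmodule.comap H.toSubmodule.subtype := by
    refine Submodule.span_le.mpr ?_
    rintro _ ⟨α, hα, rfl⟩
    have hmem := coroot_mem_corootSpace (H := H) α.1
    rw [LieAlgebra.mem_corootSpace] at hmem
    change ((coroot α.1 : H) : 𝔤) ∈ (levi R').toSubmodule
    refine (Submodule.span_le.mpr ?_) hmem
    rintro _ ⟨y, hy, z, hz, rfl⟩
    refine (levi R').lie_mem (LieSubalgebra.subset_lieSpan ?_) (LieSubalgebra.subset_lieSpan ?_)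
    · exact Set.mem_biUnion hα hy
    · have hneg : (-α.1 : LieModule.Weight ℂ H 𝔤) ∈ H.root := by
        have := LieSubalgebra.isNonZero_coe_root α
        simpa using this
      refine Set.mem_biUnion (R'.neg_mem α hα ⟨-α.1, hneg⟩ ?_) ?_
      · ext x; simp
      · simpa using hz
  exact hsub hh

/-- The inclusion of `𝔥_𝔞` into `𝔞`. -/
def leviCartanIncl (R' : ClosedRootSet H) : leviCartan R' →ₗ[ℂ] levi R' where
  toFun h := ⟨((h : H) : 𝔤), leviCartan_le R' h.2⟩
  map_add' _ _ := rfl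
  map_smul' _ _ := rfl

variable (b : (rootSystem H).Base) (R' : ClosedRootSet H)

/-- The set `R'⁺ = R' ∩ R⁺` of positive roots of `𝔞`. -/
def leviPosRoots : Set H.root := {α | α ∈ R'.roots ∧ b.IsPos α}

/-- The set of simple roots of `𝔞`: the positive roots of `𝔞` which are not the sum of two positive
roots of `𝔞`. -/
def leviSimpleRoots : Set H.root :=
  {β | β ∈ leviPosRoots b R' ∧ ¬ ∃ γ ∈ leviPosRoots b R', ∃ δ ∈ leviPosRoots b R',
    (rootSystem H).root β = (rootSystem H).root γ + (rootSystem H).root δ}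

variable {b R'} in
/-- The coroot `h_β` of a simple root `β` of `𝔞`, as an element of `𝔥_𝔞`. -/
def leviCoroot (β : leviSimpleRoots b R') : leviCartan R' :=
  ⟨(rootSystem H).coroot β.1, Submodule.subset_span ⟨β.1, β.2.1.1, rfl⟩⟩

/-- The nilpotent subalgebra `𝔫⁺_𝔞` of `𝔞` (as a subspace of `𝔞`), the sum of the root spaces of the
positive roots of `𝔞`. -/
def leviNPos : Submodule ℂ (levi R') :=
  (⨆ α : leviPosRoots b R', (rootSpace H (α : H.root).1).toSubmodule).comap
    (levi R').toSubmodule.subtype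

/-- The monoid `P⁺_𝔞` of dominant integral weights of `𝔞`. -/
def leviDominantWeights : AddSubmonoid (Dual ℂ (leviCartan R')) where
  carrier := {μ | ∀ β : leviSimpleRoots b R', ∃ m : ℕ, μ (leviCoroot β) = m}
  zero_mem' := fun _ ↦ ⟨0, by simp⟩
  add_mem' := by
    intro μ ν hμ hν β
    obtain ⟨m, hm⟩ := hμ β
    obtain ⟨n, hn⟩ := hν β
    exact ⟨m + n, by simp [hm, hn]⟩

/-- `τ` is the fundamental weight `τ_β` of `𝔞` attached to the simple root `β` of `𝔞`. -/
def IsLeviFundamentalWeight (β : leviSimpleRoots b R') (τ : Dual ℂ (leviCartan R')) : Prop :=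
  τ (leviCoroot β) = 1 ∧ ∀ γ : leviSimpleRoots b R', γ ≠ β → τ (leviCoroot γ) = 0

/-- The restriction map `π : 𝔥* → 𝔥_𝔞*`. -/
def res : Dual ℂ H →ₗ[ℂ] Dual ℂ (leviCartan R') :=
  (leviCartan R').subtype.dualMap

/-- Helper fact: `π` maps `P⁺` to `P⁺_𝔞`. -/
theorem res_mem {μ : Dual ℂ H} (hμ : μ ∈ dominantWeights b) :
    res R' μ ∈ leviDominantWeights b R' := by
  intro β
  have h := coroot_mem_closure_of_isPos b β.2.1.2
  change ∃ m : ℕ, μ ((rootSystem H).coroot β.1) = m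
  generalize (rootSystem H).coroot β.1 = y at h ⊢
  induction h using AddSubmonoid.closure_induction with
  | mem x hx =>
    obtain ⟨j, hj, rfl⟩ := hx
    exact hμ j hj
  | zero => exact ⟨0, by simp⟩
  | add x y _ _ hx hy =>
    obtain ⟨m, hm⟩ := hx
    obtain ⟨n, hn⟩ := hy
    exact ⟨m + n, by simp [hm, hn]⟩

/-- The restriction map `π : P⁺ → P⁺_𝔞`. -/
def resDominant : dominantWeights b →+ leviDominantWeights b R' where
  toFun μ := ⟨res R' μ.1, res_mem b R' μ.2⟩
  map_zero' := by ext; simp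
  map_add' _ _ := by ext; simp

/-- The pair `(𝔞, λ)` is globally admissible: writing `λ = ∑ m_i ω_i`, so that `m_i = λ(h_{α_i})`,
for every `i` with `m_i ≠ 0` the weight `π(ω_i)` is either `0` or a fundamental weight of `𝔞`. -/
def GloballyAdmissible (lam : dominantWeights b) : Prop :=
  ∀ i : b.support, lam.1 ((rootSystem H).coroot i) ≠ 0 →
    res R' (fundamentalWeight b i) = 0 ∨
      ∃ β : leviSimpleRoots b R', IsLeviFundamentalWeight b R' β (res R' (fundamentalWeight b i))

end Levi

/-! ## Finitely supported functions with values in dominant weights -/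

section FinSupp

/-- The weight `wt ψ = ∑_a ψ(a)` of a finitely supported function on `ℂ`. -/
def wt {Q : Type*} [AddCommMonoid Q] (ψ : ℂ →₀ Q) : Q := ψ.sum fun _ μ ↦ μ

/-- The set `𝓔^λ` of finitely supported functions `ℂ → Q` of weight `λ`. For `Q = P⁺` these are
the functions for `𝔤`, for `Q = P⁺_𝔞` those for `𝔞`. -/
def WeightFun {Q : Type*} [AddCommMonoid Q] (lam : Q) : Type _ := {ψ : ℂ →₀ Q // wt ψ = lam}

variable {𝔤 : Type*} [LieRing 𝔤] [LieAlgebra ℂ 𝔤] [FiniteDimensional ℂ 𝔤] [LieAlgebra.IsSimple ℂ 𝔤]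
  {H : LieSubalgebra ℂ 𝔤} [H.IsCartanSubalgebra]
  (b : (rootSystem H).Base) (R' : ClosedRootSet H)

/-- The map `π : 𝓔^λ → 𝓔_𝔞^{π(λ)}`, `ψ ↦ π ∘ ψ`. -/
def resFun (lam : dominantWeights b) (ψ : WeightFun lam) : WeightFun (resDominant b R' lam) :=
  ⟨ψ.1.mapRange (resDominant b R') (map_zero _), by
    rw [wt, Finsupp.sum_mapRange_index (fun _ ↦ rfl)]
    have h : wt ψ.1 = lam := ψ.2
    conv_rhs => rw [← h]
    rw [wt, Finsupp.sum, Finsupp.sum, map_sum]⟩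

end FinSupp

/-! ## Modules over current algebras -/

section Current

/-- The current algebra `L ⊗ ℂ[t]`, with bracket `[x ⊗ p, y ⊗ q] = [x, y] ⊗ p q` (the polynomial
factor is written on the left). -/
abbrev Current (L : Type*) [LieRing L] [LieAlgebra ℂ L] : Type _ := ℂ[X] ⊗[ℂ] L

/-- `V` is a finite-dimensional simple `L`-module of highest weight `μ` and `v` is a highest weight
vector of it. Here `ι` is the inclusion of the Cartan subalgebra into `L` and `n` is the subspace
`𝔫⁺` of `L`. If `L` is semisimple and `μ` is dominant integral, such a pair `(V, v)` exists and is
unique up to isomorphism. -/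
structure IsSimpleOfHighestWeight {𝔥 L V : Type*} [AddCommGroup 𝔥] [Module ℂ 𝔥]
    [LieRing L] [LieAlgebra ℂ L] [AddCommGroup V] [Module ℂ V] [LieRingModule L V] [LieModule ℂ L V]
    (ι : 𝔥 →ₗ[ℂ] L) (n : Submodule ℂ L) (μ : Dual ℂ 𝔥) (v : V) : Prop where
  finiteDimensional : FiniteDimensional ℂ V
  simple : LieModule.IsIrreducible ℂ L V
  ne_zero : v ≠ 0
  cartan_lie : ∀ h : 𝔥, ⁅ι h, v⁆ = μ h • v
  nPos_lie : ∀ x ∈ n, ⁅x, v⁆ = 0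

/-- The tensor product `⨂_{c ∈ s} V_c`, whose `c`-th factor will be regarded as evaluated at the
point `c`. -/
def EvalTensor (s : Finset ℂ) (V : s → Type*) [∀ c, AddCommGroup (V c)] [∀ c, Module ℂ (V c)] :
    Type _ := ⨂[ℂ] c, V c

attribute [local instance 100] LieRing.ofAssociativeRing

variable {s : Finset ℂ} {V : s → Type*} [∀ c, AddCommGroup (V c)] [∀ c, Module ℂ (V c)]

instance : AddCommGroup (EvalTensor s V) := inferInstanceAs (AddCommGroup (⨂[ℂ] c, V c))

instance : Module ℂ (EvalTensor s V) := inferInstanceAs (Module ℂ (⨂[ℂ] c, V c))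

/-- The pure tensor `⊗_c v_c`. -/
def pureTensor (v : ∀ c, V c) : EvalTensor s V := PiTensorProduct.tprod ℂ v

/-- The operator `1 ⊗ ⋯ ⊗ f ⊗ ⋯ ⊗ 1` on `⨂_c V_c`, where `f` acts on the `c`-th factor. -/
def factorEnd (c : s) : Module.End ℂ (V c) →ₗ[ℂ] Module.End ℂ (EvalTensor s V) where
  toFun f := PiTensorProduct.map (Function.update (fun _ ↦ LinearMap.id) c f)
  map_add' f g := PiTensorProduct.map_update_add _ c f g
  map_smul' r f := PiTensorProduct.map_update_smul _ c r f

theorem factorEnd_mul (c : s) (f g : Module.End ℂ (V c)) :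
    factorEnd c (f * g) = factorEnd c f * factorEnd c g := by
  change PiTensorProduct.map _ = PiTensorProduct.map _ ∘ₗ PiTensorProduct.map _
  rw [← PiTensorProduct.map_comp]
  congr 1
  funext d
  by_cases h : d = c
  · subst h; simp [Module.End.mul_eq_comp]
  · simp [Function.update_of_ne h]

theorem factorEnd_comm {c d : s} (h : c ≠ d) (f : Module.End ℂ (V c)) (g : Module.End ℂ (V d)) :
    factorEnd c f * factorEnd d g = factorEnd d g * factorEnd c f := by
  change PiTensorProduct.map _ ∘ₗ PiTensorProduct.map _ =
    PiTensorProduct.map _ ∘ₗ PiTensorProduct.map _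
  rw [← PiTensorProduct.map_comp, ← PiTensorProduct.map_comp]
  congr 1
  funext e
  by_cases hc : e = c
  · subst hc; simp [Function.update_of_ne h]
  · simp [Function.update_of_ne hc]

variable (L : Type*) [LieRing L] [LieAlgebra ℂ L] [∀ c, LieRingModule L (V c)]
  [∀ c, LieModule ℂ L (V c)]

variable (V) in
/-- The action of `L ⊗ ℂ[t]` on `⨂_c ev_c V_c`: the element `x ⊗ p` acts as
`∑_c p(c) (1 ⊗ ⋯ ⊗ x ⊗ ⋯ ⊗ 1)`. -/
def evalAction : Current L →ₗ[ℂ] Module.End ℂ (EvalTensor s V) :=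
  ∑ c : s, TensorProduct.lift
    ((Polynomial.leval (c : ℂ)).smulRight
      ((factorEnd c).comp (LieModule.toEnd ℂ L (V c)).toLinearMap))

theorem evalAction_tmul (p : ℂ[X]) (x : L) :
    evalAction V L (p ⊗ₜ x) =
      ∑ c : s, p.eval (c : ℂ) • factorEnd c (LieModule.toEnd ℂ L (V c) x) := by
  simp [evalAction, LinearMap.sum_apply]

theorem evalAction_lie (x y : Current L) :
    evalAction V L ⁅x, y⁆ =
      evalAction V L x * evalAction V L y - evalAction V L y * evalAction V L x := by
  induction x using TensorProduct.induction_on with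
  | zero =>
    have h : ⁅(0 : Current L), y⁆ = 0 := zero_lie y
    rw [h, map_zero, zero_mul, mul_zero, sub_zero]
  | add x₁ x₂ h₁ h₂ =>
    have h : ⁅(x₁ + x₂ : Current L), y⁆ = ⁅x₁, y⁆ + ⁅x₂, y⁆ := add_lie x₁ x₂ y
    rw [h, map_add, h₁, h₂, map_add]; noncomm_ring
  | tmul p x =>
    induction y using TensorProduct.induction_on with
    | zero =>
      have h : ⁅(p ⊗ₜ x : Current L), (0 : Current L)⁆ = 0 :=
        lie_zero (L := Current L) (M := Current L) (p ⊗ₜ x)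
      rw [h, map_zero, zero_mul, mul_zero, sub_zero]
    | add y₁ y₂ h₁ h₂ =>
      have h : ⁅(p ⊗ₜ x : Current L), (y₁ + y₂ : Current L)⁆ =
          ⁅(p ⊗ₜ x : Current L), y₁⁆ + ⁅(p ⊗ₜ x : Current L), y₂⁆ :=
        lie_add (L := Current L) (M := Current L) (p ⊗ₜ x) y₁ y₂
      rw [h, map_add, h₁, h₂, map_add]; noncomm_ring
    | tmul q y =>
      rw [LieAlgebra.ExtendScalars.bracket_tmul, evalAction_tmul, evalAction_tmul, evalAction_tmul,
        Finset.sum_mul_sum, Finset.sum_mul_sum]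
      rw [Finset.sum_comm (f := fun (i j : s) ↦
        (q.eval (i : ℂ) • factorEnd i (LieModule.toEnd ℂ L (V i) y)) *
          (p.eval (j : ℂ) • factorEnd j (LieModule.toEnd ℂ L (V j) x)))]
      rw [← Finset.sum_sub_distrib]
      refine Finset.sum_congr rfl fun c _ ↦ ?_
      rw [← Finset.sum_sub_distrib, Finset.sum_eq_single c]
      · rw [LieHom.map_lie, Ring.lie_def, map_sub, factorEnd_mul, factorEnd_mul, Polynomial.eval_mul,
          smul_mul_smul_comm, smul_mul_smul_comm, smul_sub, mul_comm (q.eval _)]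
      · intro d _ hd
        rw [smul_mul_smul_comm, smul_mul_smul_comm, factorEnd_comm hd.symm, mul_comm (q.eval _),
          sub_self]
      · simp

instance : LieRingModule (Current L) (EvalTensor s V) where
  bracket x m := evalAction V L x m
  add_lie x y m := by simp
  lie_add x m n := by simp
  leibniz_lie x y m := by simp [evalAction_lie]

instance : LieModule ℂ (Current L) (EvalTensor s V) where
  smul_lie r x m := by
    change evalAction V L (r • x) m = r • evalAction V L x m
    simp
  lie_smul r x m := by
    change evalAction V L x (r • m) = r • evalAction V L x m
    simp

/-- Helper fact: for a subalgebra `𝔞 ⊆ L`, the action of `𝔞 ⊗ ℂ[t]` on `⨂_c ev_c V_c` is the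
restriction of the action of `L ⊗ ℂ[t]`. -/
theorem current_subalgebra_lie (𝔞 : LieSubalgebra ℂ L) (x : Current 𝔞) (m : EvalTensor s V) :
    ⁅x, m⁆ = ⁅LieAlgebra.ExtendScalars.map (AlgHom.id ℂ ℂ[X]) 𝔞.incl x, m⁆ := by
  change evalAction V 𝔞 x m = evalAction V L _ m
  congr 1
  induction x using TensorProduct.induction_on with
  | zero => simp
  | add x y hx hy => rw [map_add, map_add, hx, hy, map_add]
  | tmul p x =>
    rw [LieAlgebra.ExtendScalars.map_apply_tmul, evalAction_tmul, evalAction_tmul]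
    rfl

/-- For a module `M` over a Lie algebra `G` and `v ∈ M`, the cyclic submodule `U(G).v`, which is the
smallest `G`-submodule containing `v`. -/
abbrev cyclic (G : Type*) [LieRing G] [LieAlgebra ℂ G] {M : Type*} [AddCommGroup M] [Module ℂ M]
    [LieRingModule G M] [LieModule ℂ G M] (v : M) : LieSubmodule ℂ G M :=
  LieSubmodule.lieSpan ℂ G {v}

end Current

end LeviCurrent

end

/-!
Write `𝔥_𝔞` for `leviCartan R'` and `P⁺_𝔞` for the dominant integral weights of `𝔞 = levi R'`.

**Simple roots of `R'`.** The indecomposable elements of `R' ∩ R⁺` generate `R' ∩ R⁺`, and pairwise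
they are obtuse, because `R'` is closed under addition and negation. The sum of all roots in
`R' ∩ R⁺` is positive on each of their coroots, and obtuse vectors in an open half space are
linearly independent, so the coroots form a basis of `𝔥_𝔞` (`leviCorootBasis`). Hence `𝔞` has fundamental
weights, and they generate `P⁺_𝔞`.

**Surjectivity of `π`.** If `(𝔞, λ)` is globally admissible, a lift of `φ` is found by induction on
the sum of the coefficients of `λ`: when `π(ω_i)` vanishes, `ω_i` may be placed anywhere, and when
`π(ω_i) = τ_β`, it is placed at a point `c` at which `φ(c)` has a positive value at the coroot of
`β`. Conversely, distribute the fundamental weights which make up `π(λ)` over distinct points. A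
lift `ψ` of this function has a value `ψ(c)` with positive `ω_i`-coefficient whenever `λ` has one,
so that `π(ω_i)` is a summand in `P⁺_𝔞` of `0` or of a fundamental weight, which leaves no choice
but `0` or that fundamental weight.

**The isomorphism.** For it any `ψ` with `π ∘ ψ = φ` will do. The submodule generated by a highest
weight vector of a finite-dimensional `𝔞`-module is simple: any submodule contains a highest weight
vector, whose weight lies below the given one and gives the same eigenvalue of the Casimir operator
of the Killing form of `𝔤` restricted to `𝔞`, and on dominant weights this forces equality
(`TriangularData.IsHighest.mem_of_le_lieSpan`). Applied to the product of two modules, this shows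
that a simple module of highest weight `χ` embeds into every finite-dimensional module with a
highest weight vector of weight `χ`, as the graph of a homomorphism
(`TriangularData.IsHighest.exists_embedding`). So `V^𝔞(φ(c))` embeds into `V(ψ(c))`, and where
`φ(c) = 0` the highest weight vector of `V(ψ(c))` is killed by `𝔞`. The tensor product of these
embeddings, with the highest weight vectors inserted at the points outside the support of `φ`, is an
injective homomorphism into `V(ψ)`. Its image is generated by `v_ψ`, because Lagrange interpolation
yields currents which act on one tensor factor only, so that a tensor product of simple modules at
distinct points is generated by any pure tensor of nonzero vectors (`nonempty_equiv_cyclic`).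
-/

noncomputable section

namespace LeviCurrent

attribute [local instance 100] LieRing.ofAssociativeRing

/-! ### Casimir operators -/

section Casimir

variable {L M I : Type*} [LieRing L] [LieAlgebra ℂ L] [AddCommGroup M] [Module ℂ M]
  [LieRingModule L M] [LieModule ℂ L M] [Fintype I]

/-- The Casimir operator `∑ᵢ xᵢ yᵢ` on a module `M` attached to two families `x`, `y` of elements
of `L`. -/
def casimir (M : Type*) [AddCommGroup M] [Module ℂ M] [LieRingModule L M] [LieModule ℂ L M]
    (x y : I → L) : M →ₗ[ℂ] M :=
  ∑ i, LieModule.toEnd ℂ L M (x i) ∘ₗ LieModule.toEnd ℂ L M (y i)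

theorem casimir_apply (x y : I → L) (m : M) : casimir M x y m = ∑ i, ⁅x i, ⁅y i, m⁆⁆ := by
  simp [casimir]

/-- If `x` and `y` are dual to each other for an invariant symmetric form, then their Casimir
operator commutes with the action of `L`. -/
theorem casimir_lie (B : L →ₗ[ℂ] L →ₗ[ℂ] ℂ) (hB : ∀ x y z, B ⁅x, y⁆ z = B x ⁅y, z⁆)
    (hsymm : ∀ x y, B x y = B y x) (x y : I → L) (hx : ∀ z, z = ∑ i, B z (y i) • x i)
    (hy : ∀ z, z = ∑ i, B z (x i) • y i) (z : L) (m : M) :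
    casimir M x y ⁅z, m⁆ = ⁅z, casimir M x y m⁆ := by
  have h1 : ∑ i, ⁅⁅z, x i⁆, ⁅y i, m⁆⁆ = ∑ i, ∑ k, B ⁅z, x i⁆ (y k) • ⁅x k, ⁅y i, m⁆⁆ := by
    refine Finset.sum_congr rfl fun i _ ↦ ?_
    conv_lhs => rw [hx ⁅z, x i⁆]
    rw [sum_lie]
    simp
  have h2 : ∑ i, ⁅x i, ⁅⁅z, y i⁆, m⁆⁆ = ∑ i, ∑ k, B ⁅z, y k⁆ (x i) • ⁅x k, ⁅y i, m⁆⁆ := by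
    rw [Finset.sum_comm]
    refine Finset.sum_congr rfl fun i _ ↦ ?_
    conv_lhs => rw [hy ⁅z, y i⁆]
    rw [sum_lie, lie_sum]
    simp
  have h3 : ∀ i k, B ⁅z, y k⁆ (x i) = -B ⁅z, x i⁆ (y k) := by
    intro i k
    rw [← lie_skew, map_neg, LinearMap.neg_apply, hB, hsymm]
  have h4 : ∑ i, ⁅⁅z, x i⁆, ⁅y i, m⁆⁆ + ∑ i, ⁅x i, ⁅⁅z, y i⁆, m⁆⁆ = 0 := by
    rw [h1, h2, ← Finset.sum_add_distrib]
    refine Finset.sum_eq_zero fun i _ ↦ ?_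
    rw [← Finset.sum_add_distrib]
    refine Finset.sum_eq_zero fun k _ ↦ ?_
    rw [h3, neg_smul, add_neg_cancel]
  rw [casimir_apply, casimir_apply, lie_sum, ← sub_eq_zero, ← neg_eq_zero, ← h4,
    ← Finset.sum_sub_distrib, ← Finset.sum_neg_distrib, ← Finset.sum_add_distrib]
  refine Finset.sum_congr rfl fun i _ ↦ ?_
  rw [leibniz_lie z (x i), leibniz_lie z (y i), lie_add]
  abel

end Casimir

/-! ### Simultaneous eigenvectors -/

section Eigen

variable {𝔱 M : Type*} [AddCommGroup 𝔱] [Module ℂ 𝔱] [AddCommGroup M] [Module ℂ M]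

/-- A commuting family of operators on a nonzero finite-dimensional space has a common
eigenvector. -/
theorem exists_common_eigenvector [FiniteDimensional ℂ M] (f : 𝔱 →ₗ[ℂ] Module.End ℂ M)
    (hf : ∀ s t, Commute (f s) (f t)) (E : Submodule ℂ M) (hE : E ≠ ⊥)
    (hinv : ∀ t, ∀ x ∈ E, f t x ∈ E) :
    ∃ x ∈ E, x ≠ 0 ∧ ∃ ν : Dual ℂ 𝔱, ∀ t, f t x = ν t • x := by
  induction hn : finrank ℂ E using Nat.strong_induction_on generalizing E with
  | _ n ih =>
  by_cases h : ∀ t, ∃ c : ℂ, ∀ x ∈ E, f t x = c • x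
  · obtain ⟨x, hx, hx0⟩ := E.exists_mem_ne_zero_of_ne_bot hE
    choose ν hν using h
    refine ⟨x, hx, hx0, ⟨⟨ν, fun s t ↦ ?_⟩, fun r t ↦ ?_⟩, fun t ↦ hν t x hx⟩
    · apply smul_left_injective ℂ hx0
      simp only [add_smul]
      rw [← hν _ x hx, ← hν _ x hx, ← hν _ x hx, map_add, LinearMap.add_apply]
    · apply smul_left_injective ℂ hx0
      simp only [RingHom.id_apply, smul_assoc]
      rw [← hν _ x hx, ← hν _ x hx, map_smul, LinearMap.smul_apply]
  · push Not at h
    obtain ⟨t, ht⟩ := h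
    have : Nontrivial E := Submodule.nontrivial_iff_ne_bot.mpr hE
    obtain ⟨c, hc⟩ := Module.End.exists_eigenvalue ((f t).restrict (hinv t))
    obtain ⟨⟨y, hyE⟩, hy⟩ := hc.exists_hasEigenvector
    have hy1 : f t y = c • y := congrArg Subtype.val hy.apply_eq_smul
    have hy0 : y ≠ 0 := fun h0 ↦ hy.2 (Subtype.ext h0)
    let E' : Submodule ℂ M := E ⊓ (f t).eigenspace c
    have hlt : E' < E := by
      refine lt_of_le_of_ne inf_le_left fun h ↦ ?_
      obtain ⟨x, hx, hx'⟩ := ht c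
      rw [← h] at hx
      exact hx' (Module.End.mem_eigenspace_iff.mp hx.2)
    have hE' : E' ≠ ⊥ := by
      intro h
      have : y ∈ E' := ⟨hyE, Module.End.mem_eigenspace_iff.mpr hy1⟩
      rw [h] at this
      exact hy0 this
    obtain ⟨x, hx, hx0, ν, hν⟩ := ih _ (hn ▸ Submodule.finrank_lt_finrank_of_lt hlt) E' hE'
      (fun s x hx ↦ ⟨hinv s x hx.1, by
        rw [SetLike.mem_coe, Module.End.mem_eigenspace_iff, ← Module.End.mul_apply, (hf t s).eq,
          Module.End.mul_apply, Module.End.mem_eigenspace_iff.mp hx.2, map_smul]⟩) rfl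
    exact ⟨x, hx.1, hx0, ν, hν⟩

/-- The simultaneous eigenspace of weight `χ` of a family of operators. -/
def jointEigenspace (f : 𝔱 →ₗ[ℂ] Module.End ℂ M) (χ : Dual ℂ 𝔱) : Submodule ℂ M :=
  ⨅ t, (f t).eigenspace (χ t)

theorem mem_jointEigenspace {f : 𝔱 →ₗ[ℂ] Module.End ℂ M} {χ : Dual ℂ 𝔱} {x : M} :
    x ∈ jointEigenspace f χ ↔ ∀ t, f t x = χ t • x := by
  simp [jointEigenspace]

theorem disjoint_jointEigenspace (f : 𝔱 →ₗ[ℂ] Module.End ℂ M)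
    (hf : ∀ s t, Commute (f s) (f t)) {K : Type*} (χ : Dual ℂ 𝔱) (η : K → Dual ℂ 𝔱)
    (h : ∀ k, η k ≠ χ) :
    Disjoint (jointEigenspace f χ) (⨆ k, jointEigenspace f (η k)) := by
  have hind := Module.End.independent_iInf_maxGenEigenspace_of_forall_mapsTo (f := fun t ↦ f t)
    (fun i j φ ↦ Module.End.mapsTo_maxGenEigenspace_of_comm (hf j i) φ)
  have hle : ∀ χ : Dual ℂ 𝔱, jointEigenspace f χ ≤ ⨅ t, (f t).maxGenEigenspace (χ t) :=
    fun χ ↦ iInf_mono fun t ↦ (f t).genEigenspace_le_maximal (χ t) 1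
  refine (hind (χ : 𝔱 → ℂ)).mono (hle χ) (iSup_le fun k ↦ (hle (η k)).trans ?_)
  exact le_iSup₂_of_le (f := fun (j : 𝔱 → ℂ) (_ : j ≠ (χ : 𝔱 → ℂ)) ↦
    ⨅ t, (f t).maxGenEigenspace (j t)) (η k : 𝔱 → ℂ)
    (fun h' ↦ h k (DFunLike.coe_injective h')) le_rfl

end Eigen

/-! ### Highest weight modules -/

/-- A triangular decomposition `L = 𝔫⁻ ⊕ 𝔱 ⊕ 𝔫⁺` of a Lie algebra, together with an invariant
symmetric form for which it has explicit dual bases. The positive roots are indexed by `Pos`. The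
scalars `r` are real, because their positivity is what bounds the weights of submodules. -/
structure TriangularData (𝔱 L Pos : Type*) [AddCommGroup 𝔱] [Module ℂ 𝔱] [LieRing L]
    [LieAlgebra ℂ L] [Fintype Pos] where
  /-- the inclusion of the Cartan subalgebra -/
  incl : 𝔱 →ₗ[ℂ] L
  /-- the positive roots -/
  root : Pos → Dual ℂ 𝔱
  /-- the coroots of the positive roots -/
  coroot : Pos → 𝔱
  /-- the positive root vectors -/
  e : Pos → L
  /-- the negative root vectors -/
  f : Pos → L
  incl_lie_incl : ∀ s t, ⁅incl s, incl t⁆ = 0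
  incl_lie_e : ∀ t α, ⁅incl t, e α⁆ = root α t • e α
  incl_lie_f : ∀ t α, ⁅incl t, f α⁆ = -(root α t) • f α
  sl2 : ∀ α, IsSl2Triple (incl (coroot α)) (e α) (f α)
  /-- the invariant form -/
  form : L →ₗ[ℂ] L →ₗ[ℂ] ℂ
  form_lie : ∀ x y z, form ⁅x, y⁆ z = form x ⁅y, z⁆
  form_symm : ∀ x y, form x y = form y x
  /-- the dimension of `𝔱` -/
  n : ℕ
  /-- an orthogonal basis of `𝔱` -/
  v : Fin n → 𝔱
  /-- the inverses of the square lengths of the basis vectors `v j` -/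
  s : Fin n → ℂ
  /-- the inverses of `form (e α) (f α)` -/
  r : Pos → ℝ
  r_pos : ∀ α, 0 < r α
  /-- the elements `s j • v j`, `r α • e α`, `r α • f α` and `v j`, `f α`, `e α` are dual to each
  other -/
  expand : ∀ z, z = ∑ j, (s j * form z (incl (v j))) • incl (v j) +
    (∑ α, ((r α : ℂ) * form z (f α)) • e α + ∑ α, ((r α : ℂ) * form z (e α)) • f α)
  /-- the root `α` corresponds to `r α • coroot α` under the identification of the dual of `𝔱` with
  `𝔱` by the form -/
  sum_root_smul : ∀ α, ∑ j, (s j * root α (v j)) • v j = (r α : ℂ) • coroot α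
  /-- positive roots are positive on the element of `𝔱` corresponding to the sum of all of them -/
  root_sum_pos : ∀ α, ∃ c : ℝ, 0 < c ∧ root α (∑ γ, (r γ : ℂ) • coroot γ) = c

namespace TriangularData

variable {𝔱 L Pos : Type*} [AddCommGroup 𝔱] [Module ℂ 𝔱] [LieRing L] [LieAlgebra ℂ L]
  [Fintype Pos] (D : TriangularData 𝔱 L Pos)

/-- `m` is a highest weight vector of weight `χ`. -/
structure IsHighest {M : Type*} [AddCommGroup M] [Module ℂ M] [LieRingModule L M]
    (χ : Dual ℂ 𝔱) (m : M) : Prop where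
  ne_zero : m ≠ 0
  incl_lie : ∀ t, ⁅D.incl t, m⁆ = χ t • m
  e_lie : ∀ α, ⁅D.e α, m⁆ = 0

/-- The element `∑ r_γ h_γ` of `𝔱`, which corresponds to the sum of the positive roots. -/
def twoRho : 𝔱 := ∑ γ, (D.r γ : ℂ) • D.coroot γ

/-- The eigenvalue of the Casimir operator on a highest weight vector of weight `χ`. -/
def casimirValue (χ : Dual ℂ 𝔱) : ℂ :=
  ∑ j, D.s j * (χ (D.v j) * χ (D.v j)) + χ D.twoRho

/-- The sum of positive roots with multiplicities `k`. -/
def rootSum (k : Pos → ℕ) : Dual ℂ 𝔱 := ∑ α, k α • D.root α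

/-- Weights that differ by a nontrivial sum of positive roots are separated by `twoRho`. -/
theorem rootSum_twoRho (k : Pos → ℕ) :
    ∃ c : ℝ, 0 ≤ c ∧ D.rootSum k D.twoRho = c ∧ (c = 0 → k = 0) := by
  choose p hp hp' using D.root_sum_pos
  refine ⟨∑ α, k α * p α, Finset.sum_nonneg fun α _ ↦ mul_nonneg (Nat.cast_nonneg _) (hp α).le,
    ?_, fun h ↦ ?_⟩
  · rw [rootSum, LinearMap.sum_apply]
    push_cast
    refine Finset.sum_congr rfl fun α _ ↦ ?_
    rw [LinearMap.smul_apply, twoRho, hp' α, nsmul_eq_mul]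
  · rw [Finset.sum_eq_zero_iff_of_nonneg
      fun α _ ↦ mul_nonneg (Nat.cast_nonneg _) (hp α).le] at h
    funext α
    simpa [(hp α).ne'] using h α (Finset.mem_univ α)

/-- If `χ = ν + κ` with `κ` a sum of positive roots, then `(χ, χ + 2ρ) - (ν, ν + 2ρ)` equals
`(κ, χ + ν) + (κ, 2ρ)`, which is a sum of nonnegative terms when `χ` and `ν` are dominant. -/
theorem casimirValue_sub (χ ν : Dual ℂ 𝔱) (k : Pos → ℕ) (h : χ = ν + D.rootSum k) :
    D.casimirValue χ - D.casimirValue ν =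
      ∑ α, k α * ((D.r α : ℂ) * (χ (D.coroot α) + ν (D.coroot α))) + D.rootSum k D.twoRho := by
  have h1 : ∀ η : Dual ℂ 𝔱, ∑ j, D.s j * (D.rootSum k (D.v j) * η (D.v j)) =
      ∑ α, k α * ((D.r α : ℂ) * η (D.coroot α)) := by
    intro η
    have : ∀ α, (D.r α : ℂ) * η (D.coroot α) = ∑ j, D.s j * D.root α (D.v j) * η (D.v j) := by
      intro α
      rw [← smul_eq_mul, ← map_smul, ← D.sum_root_smul, map_sum]
      simp
    simp_rw [this, rootSum, LinearMap.sum_apply, Finset.sum_mul, Finset.mul_sum]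
    rw [Finset.sum_comm]
    refine Finset.sum_congr rfl fun α _ ↦ Finset.sum_congr rfl fun j _ ↦ ?_
    simp
    ring
  have h2 := h1 (χ + ν)
  simp only [LinearMap.add_apply] at h2
  rw [← h2, casimirValue, casimirValue, add_sub_add_comm, ← Finset.sum_sub_distrib]
  congr 1
  · refine Finset.sum_congr rfl fun j _ ↦ ?_
    rw [h, LinearMap.add_apply]
    ring
  · rw [h, LinearMap.add_apply, add_sub_cancel_left]

section Module

variable {M : Type*} [AddCommGroup M] [Module ℂ M] [LieRingModule L M] [LieModule ℂ L M]

theorem lie_mem_of_generators (P : Submodule ℂ M) (m : M) (ht : ∀ t, ⁅D.incl t, m⁆ ∈ P)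
    (he : ∀ α, ⁅D.e α, m⁆ ∈ P) (hf : ∀ α, ⁅D.f α, m⁆ ∈ P) (z : L) : ⁅z, m⁆ ∈ P := by
  rw [D.expand z, add_lie, add_lie, sum_lie, sum_lie, sum_lie]
  simp only [smul_lie]
  exact add_mem (sum_mem fun j _ ↦ P.smul_mem _ (ht _))
    (add_mem (sum_mem fun α _ ↦ P.smul_mem _ (he α)) (sum_mem fun α _ ↦ P.smul_mem _ (hf α)))

/-- The Casimir operator of the invariant form acts on a highest weight module by a scalar. -/
theorem exists_casimir (M : Type*) [AddCommGroup M] [Module ℂ M] [LieRingModule L M]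
    [LieModule ℂ L M] : ∃ C : M →ₗ[ℂ] M, (∀ (z : L) (m : M), C ⁅z, m⁆ = ⁅z, C m⁆) ∧
      ∀ (χ : Dual ℂ 𝔱) (m : M), D.IsHighest χ m → C m = D.casimirValue χ • m := by
  let x : Fin D.n ⊕ (Pos ⊕ Pos) → L := Sum.elim (fun j ↦ D.s j • D.incl (D.v j))
    (Sum.elim (fun α ↦ (D.r α : ℂ) • D.e α) (fun α ↦ (D.r α : ℂ) • D.f α))
  let y : Fin D.n ⊕ (Pos ⊕ Pos) → L := Sum.elim (fun j ↦ D.incl (D.v j)) (Sum.elim D.f D.e)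
  refine ⟨casimir M x y, fun z m ↦ casimir_lie D.form D.form_lie D.form_symm x y ?_ ?_ z m, ?_⟩
  · intro z
    conv_lhs => rw [D.expand z]
    simp only [x, y, Fintype.sum_sum_type, Sum.elim_inl, Sum.elim_inr, smul_smul, mul_comm]
  · intro z
    conv_lhs => rw [D.expand z]
    simp only [x, y, Fintype.sum_sum_type, Sum.elim_inl, Sum.elim_inr, map_smul, smul_eq_mul]
    congr 1
    exact add_comm _ _
  · intro χ m hm
    rw [casimir_apply]
    have h1 : ∀ α, ⁅D.e α, ⁅D.f α, m⁆⁆ = χ (D.coroot α) • m := by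
      intro α
      rw [leibniz_lie, hm.e_lie, lie_zero, add_zero, (D.sl2 α).lie_e_f, hm.incl_lie]
    simp only [x, y, Fintype.sum_sum_type, Sum.elim_inl, Sum.elim_inr, smul_lie, hm.incl_lie,
      lie_smul, hm.e_lie, h1, lie_zero, Finset.sum_const_zero, add_zero, smul_smul,
      ← Finset.sum_smul, ← add_smul]
    congr 1
    simp [casimirValue, twoRho, mul_left_comm]

variable {D} {χ ν : Dual ℂ 𝔱} {m : M}

theorem IsHighest.exists_nat [FiniteDimensional ℂ M] (hm : D.IsHighest χ m) (α : Pos) :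
    ∃ n : ℕ, χ (D.coroot α) = n :=
  IsSl2Triple.HasPrimitiveVectorWith.exists_nat (t := D.sl2 α) (M := M) (m := m)
    ⟨hm.ne_zero, hm.incl_lie _, hm.e_lie α⟩

/-- Two linked highest weights with the same Casimir eigenvalue agree. -/
theorem IsHighest.eq_zero_of_casimirValue_eq [FiniteDimensional ℂ M] (hm : D.IsHighest χ m)
    {w : M} (hw : D.IsHighest ν w) {k : Pos → ℕ} (hk : χ = ν + D.rootSum k)
    (hc : D.casimirValue χ = D.casimirValue ν) : k = 0 := by
  have h := D.casimirValue_sub χ ν k hk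
  obtain ⟨c, hc0, hc1, hc2⟩ := D.rootSum_twoRho k
  choose a ha using hm.exists_nat
  choose a' ha' using hw.exists_nat
  rw [hc, sub_self, hc1] at h
  simp only [ha, ha'] at h
  have h' : (0 : ℝ) = ∑ α, k α * (D.r α * (a α + a' α)) + c := by exact_mod_cast h
  have h'' : 0 ≤ ∑ α, (k α : ℝ) * (D.r α * (a α + a' α)) :=
    Finset.sum_nonneg fun α _ ↦ mul_nonneg (Nat.cast_nonneg _)
      (mul_nonneg (D.r_pos α).le (by positivity))
  exact hc2 (by linarith)

variable (D) in
/-- The action of the Cartan subalgebra on a module. -/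
def cartanEnd (M : Type*) [AddCommGroup M] [Module ℂ M] [LieRingModule L M] [LieModule ℂ L M] :
    𝔱 →ₗ[ℂ] Module.End ℂ M :=
  (LieModule.toEnd ℂ L M).toLinearMap ∘ₗ D.incl

variable (D) in
theorem commute_cartanEnd (s t : 𝔱) : Commute (D.cartanEnd M s) (D.cartanEnd M t) := by
  ext m
  change ⁅D.incl s, ⁅D.incl t, m⁆⁆ = ⁅D.incl t, ⁅D.incl s, m⁆⁆
  rw [leibniz_lie, D.incl_lie_incl, zero_lie, zero_add]

theorem mem_weight {x : M} :
    x ∈ jointEigenspace (D.cartanEnd M) χ ↔ ∀ t, ⁅D.incl t, x⁆ = χ t • x :=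
  mem_jointEigenspace

/-- The weights of a highest weight module: apart from the line spanned by the highest weight
vector, all weights are strictly lower. -/
theorem IsHighest.lieSpan_le (hm : D.IsHighest χ m) :
    (LieSubmodule.lieSpan ℂ L {m} : LieSubmodule ℂ L M).toSubmodule ≤
      Submodule.span ℂ {m} ⊔ ⨆ k : {k : Pos → ℕ // k ≠ 0},
        jointEigenspace (D.cartanEnd M) (χ - D.rootSum k.1) := by
  classical
  set S := Submodule.span ℂ {m} ⊔ ⨆ k : {k : Pos → ℕ // k ≠ 0},
        jointEigenspace (D.cartanEnd M) (χ - D.rootSum k.1) with hS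
  -- the smallest subspace which contains `m` and is stable under `𝔫⁻`
  let P : Submodule ℂ M := sInf {Q | m ∈ Q ∧ ∀ α, ∀ x ∈ Q, ⁅D.f α, x⁆ ∈ Q}
  have hmP : m ∈ P := by
    rw [Submodule.mem_sInf]; exact fun Q hQ ↦ hQ.1
  have hfP : ∀ α, ∀ x ∈ P, ⁅D.f α, x⁆ ∈ P := by
    intro α x hx
    rw [Submodule.mem_sInf] at hx ⊢
    exact fun Q hQ ↦ hQ.2 α x (hx Q hQ)
  -- the vectors of `P` which `L` does not move out of `P` form another such subspace
  let Y : Submodule ℂ M :=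
    { carrier := {x | x ∈ P ∧ ∀ z : L, ⁅z, x⁆ ∈ P}
      zero_mem' := ⟨zero_mem _, fun z ↦ by rw [lie_zero]; exact zero_mem _⟩
      add_mem' := fun hx hy ↦ ⟨add_mem hx.1 hy.1, fun z ↦ by
        rw [lie_add]; exact add_mem (hx.2 z) (hy.2 z)⟩
      smul_mem' := fun c x hx ↦ ⟨P.smul_mem c hx.1, fun z ↦ by
        rw [lie_smul]; exact P.smul_mem c (hx.2 z)⟩ }
  have hPY : P ≤ Y := by
    refine sInf_le ⟨⟨hmP, D.lie_mem_of_generators P m (fun t ↦ ?_) (fun α ↦ ?_) (fun α ↦ ?_)⟩, ?_⟩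
    · rw [hm.incl_lie]; exact P.smul_mem _ hmP
    · rw [hm.e_lie]; exact zero_mem _
    · exact hfP α m hmP
    · rintro α x ⟨hx, hx'⟩
      refine ⟨hfP α x hx, fun z ↦ ?_⟩
      rw [leibniz_lie]
      exact add_mem (hx' _) (hfP α _ (hx' z))
  have hPS : P ≤ S := by
    have hW : ∀ {k : Pos → ℕ}, k ≠ 0 → ∀ x ∈ jointEigenspace (D.cartanEnd M) (χ - D.rootSum k),
        x ∈ S := fun {k} hk x hx ↦
      Submodule.mem_sup_right (Submodule.mem_iSup_of_mem (⟨k, hk⟩ : {k : Pos → ℕ // k ≠ 0}) hx)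
    have hlow : ∀ α (k : Pos → ℕ), ∀ x ∈ jointEigenspace (D.cartanEnd M) (χ - D.rootSum k),
        ⁅D.f α, x⁆ ∈ S := by
      intro α k x hx
      have hne : k + Pi.single α 1 ≠ 0 := fun h ↦ by simpa using congrFun h α
      refine hW hne _ ?_
      have hsum : D.rootSum (k + Pi.single α 1) = D.rootSum k + D.root α := by
        simp [rootSum, add_smul, Finset.sum_add_distrib, Pi.single_apply]
      rw [mem_weight] at hx ⊢
      intro t
      rw [leibniz_lie, D.incl_lie_f, hx t, smul_lie, lie_smul, ← add_smul, hsum]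
      congr 1
      simp
      ring
    refine sInf_le ⟨Submodule.mem_sup_left (Submodule.mem_span_singleton_self m), ?_⟩
    intro α x hx
    have hle : S ≤ S.comap (LieModule.toEnd ℂ L M (D.f α)) := by
      refine sup_le ?_ (iSup_le fun k x hx ↦ hlow α k.1 x hx)
      rw [Submodule.span_singleton_le_iff_mem]
      refine hlow α 0 m (mem_weight.mpr fun t ↦ ?_)
      simp [rootSum, hm.incl_lie]
    exact hle hx
  let P' : LieSubmodule ℂ L M := { P with lie_mem := fun {z x} hx ↦ (hPY hx).2 z }
  have : LieSubmodule.lieSpan ℂ L {m} ≤ P' := by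
    rw [LieSubmodule.lieSpan_le]
    rintro _ rfl
    exact hmP
  exact le_trans (fun x hx ↦ this hx) hPS

variable (D) in
/-- Every nonzero finite-dimensional module contains a highest weight vector. -/
theorem exists_isHighest [FiniteDimensional ℂ M] (N : LieSubmodule ℂ L M) (hN : N ≠ ⊥) :
    ∃ w ∈ N, ∃ ν, D.IsHighest ν w := by
  let g := D.cartanEnd M D.twoRho
  have hg : ∀ x ∈ N.toSubmodule, g x ∈ N.toSubmodule := fun x hx ↦
    N.lie_mem (x := D.incl D.twoRho) hx
  have hN' : N.toSubmodule ≠ ⊥ := by simpa using hN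
  have : Nontrivial N.toSubmodule := Submodule.nontrivial_iff_ne_bot.mpr hN'
  -- an eigenspace of `∑ r_γ h_γ` for an eigenvalue of largest real part is killed by `𝔫⁺`
  let ev : Set ℂ := {c | Module.End.HasEigenvalue (g.restrict hg) c}
  have hfin : ev.Finite := Module.End.finite_hasEigenvalue _
  obtain ⟨c, hc, hmax⟩ := hfin.exists_maximalFor Complex.re ev
    (Module.End.exists_eigenvalue (g.restrict hg))
  have hev : ∀ (c' : ℂ) (x : M), x ∈ N → x ≠ 0 → g x = c' • x → c' ∈ ev := by
    intro c' x hx hx0 hgx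
    refine Module.End.hasEigenvalue_of_hasEigenvector (x := (⟨x, hx⟩ : N.toSubmodule))
      ⟨Module.End.mem_eigenspace_iff.mpr (Subtype.ext hgx), fun h ↦ hx0 (congrArg Subtype.val h)⟩
  obtain ⟨⟨y, hyN⟩, hy⟩ := hc.exists_hasEigenvector
  have hy1 : g y = c • y := congrArg Subtype.val hy.apply_eq_smul
  have hy0 : y ≠ 0 := fun h0 ↦ hy.2 (Subtype.ext h0)
  let E : Submodule ℂ M := N.toSubmodule ⊓ g.eigenspace c
  have hE : E ≠ ⊥ := by
    intro h
    have : y ∈ E := ⟨hyN, Module.End.mem_eigenspace_iff.mpr hy1⟩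
    rw [h] at this
    exact hy0 this
  obtain ⟨w, hw, hw0, ν, hν⟩ := exists_common_eigenvector (D.cartanEnd M) D.commute_cartanEnd E hE
    (fun s x hx ↦ ⟨N.lie_mem hx.1, by
      rw [SetLike.mem_coe, Module.End.mem_eigenspace_iff, ← Module.End.mul_apply,
        (D.commute_cartanEnd D.twoRho s).eq, Module.End.mul_apply,
        Module.End.mem_eigenspace_iff.mp hx.2, map_smul]⟩)
  refine ⟨w, hw.1, ν, hw0, hν, fun α ↦ ?_⟩
  by_contra hne
  obtain ⟨p, hp, hp'⟩ := D.root_sum_pos α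
  have hgw : ⁅D.incl D.twoRho, w⁆ = c • w := Module.End.mem_eigenspace_iff.mp hw.2
  have hmem := hev (p + c) ⁅D.e α, w⁆ (N.lie_mem hw.1) hne (by
    change ⁅D.incl D.twoRho, ⁅D.e α, w⁆⁆ = _
    rw [leibniz_lie, D.incl_lie_e, hgw, smul_lie, lie_smul, ← add_smul]
    rw [twoRho, hp'])
  have := hmax hmem (by simp [hp.le])
  simp at this
  linarith

/-- A finite-dimensional highest weight module is irreducible: any nonzero submodule contains the
highest weight vector. -/
theorem IsHighest.mem_of_le_lieSpan [FiniteDimensional ℂ M] (hm : D.IsHighest χ m)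
    {N : LieSubmodule ℂ L M} (hN : N ≠ ⊥) (hle : N ≤ LieSubmodule.lieSpan ℂ L {m}) : m ∈ N := by
  obtain ⟨w, hwN, ν, hw⟩ := D.exists_isHighest N hN
  have hwS := hm.lieSpan_le (hle hwN)
  have hww : w ∈ jointEigenspace (D.cartanEnd M) ν := mem_weight.mpr hw.incl_lie
  have hmw : m ∈ jointEigenspace (D.cartanEnd M) χ := mem_weight.mpr hm.incl_lie
  obtain ⟨C, hC, hC'⟩ := D.exists_casimir M
  have hCN : C w = D.casimirValue χ • w := by
    let K : LieSubmodule ℂ L M :=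
      { LinearMap.ker (C - D.casimirValue χ • (LinearMap.id : M →ₗ[ℂ] M)) with
        lie_mem := by
          intro z x hx
          simp only [AddSubsemigroup.mem_carrier, AddSubmonoid.mem_toSubsemigroup,
            Submodule.mem_toAddSubmonoid, LinearMap.mem_ker, LinearMap.sub_apply,
            LinearMap.smul_apply, LinearMap.id_apply, sub_eq_zero] at hx ⊢
          rw [hC, hx, lie_smul] }
    have hK : LieSubmodule.lieSpan ℂ L {m} ≤ K := by
      rw [LieSubmodule.lieSpan_le]
      rintro _ rfl
      change (C - D.casimirValue χ • (LinearMap.id : M →ₗ[ℂ] M)) _ = 0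
      simp [hC' χ _ hm]
    have : (C - D.casimirValue χ • (LinearMap.id : M →ₗ[ℂ] M)) w = 0 := hK (hle hwN)
    simpa [sub_eq_zero] using this
  have hcas : D.casimirValue χ = D.casimirValue ν :=
    smul_left_injective ℂ hw.ne_zero (hCN.symm.trans (hC' ν w hw))
  have hex : ∃ k : Pos → ℕ, χ - D.rootSum k = ν := by
    by_contra! hne
    refine hw.ne_zero (Submodule.disjoint_def.mp
      (disjoint_jointEigenspace (D.cartanEnd M) D.commute_cartanEnd ν _ hne) w hww ?_)
    have hsup : Submodule.span ℂ {m} ⊔ ⨆ k : {k : Pos → ℕ // k ≠ 0},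
        jointEigenspace (D.cartanEnd M) (χ - D.rootSum k.1) ≤
          ⨆ k, jointEigenspace (D.cartanEnd M) (χ - D.rootSum k) := by
      refine sup_le ?_ (iSup_le fun k ↦
        le_iSup (fun k ↦ jointEigenspace (D.cartanEnd M) (χ - D.rootSum k)) k.1)
      rw [Submodule.span_singleton_le_iff_mem]
      exact Submodule.mem_iSup_of_mem 0 (by simpa [rootSum] using hmw)
    exact hsup hwS
  obtain ⟨k, hk⟩ := hex
  have hk0 := hm.eq_zero_of_casimirValue_eq hw (sub_eq_iff_eq_add.mp hk) hcas
  have hχν : ν = χ := by simpa [hk0, rootSum] using hk.symm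
  obtain ⟨y, hy, z, hz, hyz⟩ := Submodule.mem_sup.mp hwS
  obtain ⟨a, rfl⟩ := Submodule.mem_span_singleton.mp hy
  have hz0 : z = 0 := by
    refine Submodule.disjoint_def.mp (disjoint_jointEigenspace (D.cartanEnd M) D.commute_cartanEnd χ
      (fun k : {k : Pos → ℕ // k ≠ 0} ↦ χ - D.rootSum k.1) fun k h ↦ k.2 ?_) z ?_ hz
    · obtain ⟨c, -, hc1, hc2⟩ := D.rootSum_twoRho k.1
      refine hc2 ?_
      rw [sub_eq_self.mp h] at hc1
      simpa using hc1.symm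
    · rw [← eq_sub_iff_add_eq'] at hyz
      rw [hyz]
      exact sub_mem (hχν ▸ hww) (Submodule.smul_mem _ _ hmw)
  rw [hz0, add_zero] at hyz
  have ha : a ≠ 0 := by
    rintro rfl
    exact hw.ne_zero (by rw [← hyz, zero_smul])
  have : m = a⁻¹ • w := by rw [← hyz, smul_smul, inv_mul_cancel₀ ha, one_smul]
  rw [this]
  exact N.smul_mem _ hwN

end Module

section Prod

variable {M₁ M₂ : Type*} [AddCommGroup M₁] [Module ℂ M₁] [LieRingModule L M₁] [LieModule ℂ L M₁]
  [AddCommGroup M₂] [Module ℂ M₂] [LieRingModule L M₂] [LieModule ℂ L M₂]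

/-- The componentwise action of a Lie algebra on a product of two modules. -/
instance prodLieRingModule : LieRingModule L (M₁ × M₂) where
  bracket x m := (⁅x, m.1⁆, ⁅x, m.2⁆)
  add_lie x y m := by ext <;> simp
  lie_add x m n := by ext <;> simp
  leibniz_lie x y m := by ext <;> simp

instance prodLieModule : LieModule ℂ L (M₁ × M₂) where
  smul_lie c x m := Prod.ext (smul_lie c x m.1) (smul_lie c x m.2)
  lie_smul c x m := Prod.ext (lie_smul c x m.1) (lie_smul c x m.2)

variable {D}

/-- The simple module of highest weight `χ` embeds into every finite-dimensional module with a
highest weight vector of weight `χ`: the submodule of the product generated by the pair of highest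
weight vectors is irreducible, hence the graph of such an embedding. -/
theorem IsHighest.exists_embedding [FiniteDimensional ℂ M₁] [FiniteDimensional ℂ M₂]
    [LieModule.IsIrreducible ℂ L M₁] {χ : Dual ℂ 𝔱} {m₁ : M₁} {m₂ : M₂}
    (h₁ : D.IsHighest χ m₁) (h₂ : D.IsHighest χ m₂) :
    ∃ g : M₁ →ₗ⁅ℂ, L⁆ M₂, Function.Injective g ∧ g m₁ = m₂ := by
  have hm : D.IsHighest χ ((m₁, m₂) : M₁ × M₂) :=
    ⟨fun h ↦ h₁.ne_zero (congrArg Prod.fst h),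
      fun t ↦ Prod.ext (h₁.incl_lie t) (h₂.incl_lie t),
      fun α ↦ Prod.ext (h₁.e_lie α) (h₂.e_lie α)⟩
  let N : LieSubmodule ℂ L (M₁ × M₂) := LieSubmodule.lieSpan ℂ L {((m₁, m₂) : M₁ × M₂)}
  have hmN : (m₁, m₂) ∈ N := LieSubmodule.subset_lieSpan rfl
  let fst : M₁ × M₂ →ₗ⁅ℂ, L⁆ M₁ := { LinearMap.fst ℂ M₁ M₂ with map_lie' := rfl }
  let snd : M₁ × M₂ →ₗ⁅ℂ, L⁆ M₂ := { LinearMap.snd ℂ M₁ M₂ with map_lie' := rfl }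
  let p : N →ₗ⁅ℂ, L⁆ M₁ := fst.comp N.incl
  have hinj : Function.Injective p := by
    rw [← LieModuleHom.ker_eq_bot, LieSubmodule.eq_bot_iff]
    intro x hx
    by_contra hx0
    have hK : N ⊓ fst.ker ≠ ⊥ := by
      intro h
      have : (x : M₁ × M₂) ∈ N ⊓ fst.ker := ⟨x.2, hx⟩
      rw [h, LieSubmodule.mem_bot] at this
      exact hx0 (Subtype.ext this)
    exact h₁.ne_zero (hm.mem_of_le_lieSpan hK inf_le_left).2
  have hsurj : Function.Surjective p := by
    rw [← LieModuleHom.range_eq_top]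
    have hmem : m₁ ∈ p.range := ⟨⟨(m₁, m₂), hmN⟩, rfl⟩
    have : Nontrivial p.range := ⟨⟨⟨m₁, hmem⟩, 0, fun h ↦ h₁.ne_zero (congrArg Subtype.val h)⟩⟩
    exact LieSubmodule.eq_top_of_isIrreducible ℂ L M₁ _
  let P : N ≃ₗ⁅ℂ, L⁆ M₁ :=
    { LinearEquiv.ofBijective p.toLinearMap ⟨hinj, hsurj⟩ with map_lie' := p.map_lie _ _ }
  let g : M₁ →ₗ⁅ℂ, L⁆ M₂ := (snd.comp N.incl).comp P.symm.toLieModuleHom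
  have hg : g m₁ = m₂ := by
    have : P.symm m₁ = ⟨(m₁, m₂), hmN⟩ := by
      apply hinj
      exact P.apply_symm_apply m₁
    change ((P.symm m₁ : N) : M₁ × M₂).2 = m₂
    rw [this]
  refine ⟨g, ?_, hg⟩
  rw [← LieModuleHom.ker_eq_bot]
  by_contra hker
  have : g.ker = ⊤ := (eq_bot_or_eq_top g.ker).resolve_left hker
  have hmem : m₁ ∈ g.ker := this ▸ LieSubmodule.mem_top _
  exact h₂.ne_zero (hg ▸ hmem)

end Prod

end TriangularData

/-! ### Closed sets of roots -/

section ClosedRoots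

variable {𝔤 : Type*} [LieRing 𝔤] [LieAlgebra ℂ 𝔤] [FiniteDimensional ℂ 𝔤] [LieAlgebra.IsSimple ℂ 𝔤]
  {H : LieSubalgebra ℂ 𝔤} [H.IsCartanSubalgebra]

theorem apply_coroot_eq_pairingIn (γ α : H.root) :
    γ.1 (coroot α.1) = ((rootSystem H).pairingIn ℤ γ α : ℂ) := by
  have := (rootSystem H).algebraMap_pairingIn ℤ γ α
  simpa using this.symm

theorem root_reflectionPerm_eq (α γ : H.root) :
    (rootSystem H).root ((rootSystem H).reflectionPerm α γ) =
      (rootSystem H).root γ + (-(rootSystem H).pairingIn ℤ γ α) • (rootSystem H).root α := by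
  rw [RootPairing.root_reflectionPerm, RootPairing.reflection_apply_root' (S := ℤ), neg_smul,
    sub_eq_add_neg]

theorem root_reflectionPerm_self (α : H.root) :
    (rootSystem H).root ((rootSystem H).reflectionPerm α α) = -(rootSystem H).root α := by
  rw [RootPairing.root_reflectionPerm, RootPairing.reflection_apply_self]

/-- Pairings are additive in the first root. -/
theorem pairingIn_of_root_eq {β γ δ : H.root} {z : ℤ} (α : H.root)
    (h : (rootSystem H).root β = (rootSystem H).root γ + z • (rootSystem H).root δ) :
    (rootSystem H).pairingIn ℤ β α =
      (rootSystem H).pairingIn ℤ γ α + z * (rootSystem H).pairingIn ℤ δ α := by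
  have h' := congrArg (fun f : Dual ℂ H ↦ f (coroot α.1)) h
  simp only [LinearMap.add_apply, LinearMap.smul_apply, rootSystem_root_apply,
    LieModule.Weight.toLinear_apply, apply_coroot_eq_pairingIn, zsmul_eq_mul] at h'
  exact_mod_cast h'

theorem pairingIn_reflectionPerm (α γ : H.root) :
    (rootSystem H).pairingIn ℤ ((rootSystem H).reflectionPerm α γ) α =
      -(rootSystem H).pairingIn ℤ γ α := by
  rw [pairingIn_of_root_eq α (root_reflectionPerm_eq α γ), RootPairing.pairingIn_same]
  ring

variable {R' : ClosedRootSet H}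

theorem ClosedRootSet.reflectionPerm_self_mem {α : H.root} (hα : α ∈ R'.roots) :
    (rootSystem H).reflectionPerm α α ∈ R'.roots :=
  R'.neg_mem α hα _ (root_reflectionPerm_self α)

/-- When `n = ⟨γ, α^∨⟩` is positive and `γ ≠ α`, the difference `δ = γ - α` is a root of `R'`. It is
the reflection of `γ` if `n = 1`, and if `n ≥ 2`, the reflection `γ - n α` of `γ` is the sum of the
reflection `δ - (n - 2) α` of `δ` and of `-α`. -/
theorem ClosedRootSet.reflectionPerm_mem_of_eq_nat {α : H.root} (hα : α ∈ R'.roots) (n : ℕ)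
    {γ : H.root} (hγ : γ ∈ R'.roots) (hn : (rootSystem H).pairingIn ℤ γ α = n) :
    (rootSystem H).reflectionPerm α γ ∈ R'.roots := by
  induction n using Nat.strong_induction_on generalizing γ with
  | _ n ih =>
  by_cases hγα : γ = α
  · subst hγα
    exact reflectionPerm_self_mem hγ
  rcases Nat.eq_zero_or_pos n with rfl | hpos
  · have : (rootSystem H).reflectionPerm α γ = γ := by
      apply (rootSystem H).root.injective
      rw [root_reflectionPerm_eq, hn]
      simp
    rwa [this]
  obtain ⟨δ, hδ⟩ := (rootSystem H).root_sub_root_mem_of_pairingIn_pos (i := γ) (j := α)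
    (by rw [hn]; exact_mod_cast hpos) hγα
  have hδR : δ ∈ R'.roots := R'.add_mem γ hγ _ (reflectionPerm_self_mem hα) δ (by
    rw [hδ, root_reflectionPerm_self, sub_eq_add_neg])
  have hδn : (rootSystem H).pairingIn ℤ δ α = n - 2 := by
    rw [pairingIn_of_root_eq (γ := γ) (δ := α) (z := -1) α
      (by rw [hδ, neg_one_smul, sub_eq_add_neg]), hn, RootPairing.pairingIn_same]
    ring
  rcases Nat.lt_or_ge n 2 with h2 | h2
  · have : (rootSystem H).reflectionPerm α γ = δ := by
      apply (rootSystem H).root.injective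
      have h1 : n = 1 := by omega
      rw [root_reflectionPerm_eq, hn, hδ, h1]
      simp [sub_eq_add_neg]
    rwa [this]
  · refine R'.add_mem _ (ih (n - 2) (by omega) hδR (by rw [hδn]; push_cast [h2]; ring))
      _ (reflectionPerm_self_mem hα) _ ?_
    rw [root_reflectionPerm_eq, root_reflectionPerm_eq, root_reflectionPerm_self, hδ, hδn, hn]
    module

/-- A closed set of roots is stable under the reflections in its roots. -/
theorem ClosedRootSet.reflectionPerm_mem {α : H.root} (hα : α ∈ R'.roots)
    {γ : H.root} (hγ : γ ∈ R'.roots) : (rootSystem H).reflectionPerm α γ ∈ R'.roots := by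
  obtain ⟨n, hn | hn⟩ := Int.eq_nat_or_neg ((rootSystem H).pairingIn ℤ γ α)
  · exact reflectionPerm_mem_of_eq_nat hα n hγ hn
  · set γ' := (rootSystem H).reflectionPerm γ γ
    have h1 : (rootSystem H).root γ' = -(rootSystem H).root γ := root_reflectionPerm_self γ
    have h2 : (rootSystem H).pairingIn ℤ γ' α = n := by
      have : (rootSystem H).root γ' =
          (rootSystem H).root γ + (-2 : ℤ) • (rootSystem H).root γ := by rw [h1]; module
      rw [pairingIn_of_root_eq α this, hn]
      ring
    have h3 := reflectionPerm_mem_of_eq_nat hα n (reflectionPerm_self_mem hγ) h2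
    refine R'.neg_mem _ h3 _ ?_
    rw [root_reflectionPerm_eq, root_reflectionPerm_eq, h1, h2, hn]
    module

variable {b : (rootSystem H).Base}

/-- The reflection in a positive root of a closed set `R'` permutes those positive roots of `R'`
which it does not make negative, and the others have positive pairing with it. Hence the sum of the
positive roots of `R'` is positive on the coroots of all positive roots of `R'`. -/
theorem sum_pairingIn_pos {α : H.root} (hα : α ∈ leviPosRoots b R')
    [Fintype (leviPosRoots b R')] :
    0 < ∑ γ : leviPosRoots b R', (rootSystem H).pairingIn ℤ γ.1 α := by
  classical
  let σ := (rootSystem H).reflectionPerm α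
  let S : Finset (leviPosRoots b R') := Finset.univ.filter fun γ ↦ σ γ.1 ∈ leviPosRoots b R'
  have hσσ : ∀ γ, σ (σ γ) = γ := fun γ ↦ RootPairing.reflectionPerm_self _ α γ
  have hS : ∑ γ ∈ S, (rootSystem H).pairingIn ℤ γ.1 α = 0 := by
    refine Finset.sum_involution (fun γ hγ ↦ ⟨σ γ.1, (Finset.mem_filter.mp hγ).2⟩) ?_ ?_ ?_ ?_
    · intro γ _
      simp only [σ, pairingIn_reflectionPerm, add_neg_cancel]
    · intro γ _ hne heq
      have := congrArg (fun γ : leviPosRoots b R' ↦ (rootSystem H).pairingIn ℤ γ.1 α) heq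
      simp only [σ, pairingIn_reflectionPerm] at this
      omega
    · intro γ hγ
      rw [Finset.mem_filter]
      exact ⟨Finset.mem_univ _, by simpa only [hσσ] using γ.2⟩
    · intro γ _
      exact Subtype.ext (hσσ γ.1)
  have hS' : ∀ γ ∈ Sᶜ, 0 < (rootSystem H).pairingIn ℤ γ.1 α := by
    intro γ hγ
    by_contra! hle
    refine (Finset.mem_compl.mp hγ) (Finset.mem_filter.mpr ⟨Finset.mem_univ _,
      ClosedRootSet.reflectionPerm_mem hα.1 γ.2.1, ?_⟩)
    have h1 := b.height_add_zsmul (root_reflectionPerm_eq α γ.1)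
    have h2 : 0 < b.height γ.1 := γ.2.2
    have h3 : 0 < b.height α := hα.2
    change 0 < b.height _
    rw [h1, smul_eq_mul]
    nlinarith
  have hαS : (⟨α, hα⟩ : leviPosRoots b R') ∈ Sᶜ := by
    rw [Finset.mem_compl, Finset.mem_filter]
    rintro ⟨-, h⟩
    have h1 := b.height_add_zsmul (root_reflectionPerm_eq α α)
    rw [RootPairing.pairingIn_same, smul_eq_mul] at h1
    have h2 : 0 < b.height (σ α) := h.2
    have h3 : 0 < b.height α := hα.2
    have h4 : b.height (σ α) = b.height α + -2 * b.height α := h1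
    omega
  rw [← Finset.sum_add_sum_compl S, hS, zero_add]
  exact Finset.sum_pos hS' ⟨_, hαS⟩

/-! ### The Killing form on the span of the coroots of a closed set of roots -/

theorem traceForm_eq_sum (x y : H) :
    LieModule.traceForm ℂ H 𝔤 x y = ∑ γ : H.root, γ.1 x * γ.1 y := by
  have h := LinearMap.congr_fun₂ (restrict_killingForm_eq_sum (K := ℂ) (L := 𝔤) (H := H)) x y
  rw [restrict_killingForm] at h
  rw [h, ← Finset.sum_coe_sort, LinearMap.sum_apply, LinearMap.sum_apply]
  rfl

theorem eq_zero_of_root_eq_zero {x : H} (h : ∀ γ : H.root, γ.1 x = 0) : x = 0 := by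
  apply (cartanEquivDual H).injective
  ext y
  change LieModule.traceForm ℂ H 𝔤 x y = _
  rw [traceForm_eq_sum]
  simp [h]

/-- Under the identification of `𝔥*` with `𝔥` by the Killing form, a root is a positive multiple of
its coroot. -/
theorem exists_pos_smul_coroot (α : H.root) : ∃ r : ℝ, 0 < r ∧
    (cartanEquivDual H).symm ((rootSystem H).root α) = (r : ℂ) • coroot α.1 := by
  have hα : α.1.IsNonZero := LieSubalgebra.isNonZero_coe_root α
  set t := (cartanEquivDual H).symm ((rootSystem H).root α) with ht
  have ht0 : α.1 t ≠ 0 := root_apply_cartanEquivDual_symm_ne_zero hα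
  have h1 := traceForm_coroot α.1 (coroot α.1)
  rw [traceForm_eq_sum, root_apply_coroot hα] at h1
  set N : ℤ := ∑ γ : H.root, (rootSystem H).pairingIn ℤ γ α * (rootSystem H).pairingIn ℤ γ α
  have hN : 0 < N := by
    refine Finset.sum_pos' (fun γ _ ↦ mul_self_nonneg _) ⟨α, Finset.mem_univ _, ?_⟩
    rw [RootPairing.pairingIn_same]
    norm_num
  have h2 : (N : ℂ) = 4 * (α.1 t)⁻¹ := by
    simp only [apply_coroot_eq_pairingIn] at h1
    push_cast [N]
    rw [h1]
    change 2 • (α.1 t)⁻¹ • (2 : ℂ) = _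
    simp
    ring
  refine ⟨2 / N, by positivity, ?_⟩
  change t = _ • (2 • (α.1 t)⁻¹ • t)
  have h3 : ((2 / N : ℝ) : ℂ) * (2 * (α.1 t)⁻¹) = 1 := by
    push_cast
    rw [h2]
    field_simp
    norm_num
  rw [← Nat.cast_smul_eq_nsmul ℂ, smul_smul, smul_smul, Nat.cast_ofNat, mul_assoc, h3, one_smul]

theorem mem_leviCartan_iff {x : H} [Fintype R'.roots] :
    x ∈ leviCartan R' ↔ ∃ c : R'.roots → ℂ, ∑ α, c α • coroot α.1.1 = x := by
  rw [leviCartan, Set.image_eq_range, Submodule.mem_span_range_iff_exists_fun]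
  rfl

/-- The Killing form is nondegenerate on `𝔥_𝔞`: roots take integral values on coroots, so pairing a
combination of coroots with its complex conjugate gives a sum of squares. -/
theorem eq_zero_of_traceForm_leviCartan_eq_zero {x : H} (hx : x ∈ leviCartan R')
    (h : ∀ y ∈ leviCartan R', LieModule.traceForm ℂ H 𝔤 x y = 0) : x = 0 := by
  classical
  have : Fintype R'.roots := Fintype.ofFinite _
  obtain ⟨c, rfl⟩ := mem_leviCartan_iff.mp hx
  have h0 := h (∑ α, (starRingEnd ℂ (c α)) • coroot α.1.1) (mem_leviCartan_iff.mpr ⟨_, rfl⟩)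
  rw [traceForm_eq_sum] at h0
  have hconj : ∀ γ : H.root, γ.1 (∑ α, (starRingEnd ℂ (c α)) • coroot α.1.1) =
      starRingEnd ℂ (γ.1 (∑ α, c α • coroot α.1.1)) := by
    intro γ
    simp only [← LieModule.Weight.toLinear_apply, map_sum, map_smul, smul_eq_mul]
    refine Finset.sum_congr rfl fun α _ ↦ ?_
    rw [LieModule.Weight.toLinear_apply, apply_coroot_eq_pairingIn]
    simp
  simp only [hconj, Complex.mul_conj] at h0
  have h1 : ∑ γ : H.root, Complex.normSq (γ.1 (∑ α, c α • coroot α.1.1)) = 0 := by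
    exact_mod_cast h0
  rw [Finset.sum_eq_zero_iff_of_nonneg fun _ _ ↦ Complex.normSq_nonneg _] at h1
  exact eq_zero_of_root_eq_zero fun γ ↦ Complex.normSq_eq_zero.mp (h1 γ (Finset.mem_univ γ))

variable (R') in
/-- The expansion of the elements of `𝔥_𝔞` in an orthogonal basis `v` for the Killing form. -/
theorem exists_orthogonal_leviCartan : ∃ (n : ℕ) (v : Fin n → leviCartan R') (s : Fin n → ℂ),
    ∀ x : leviCartan R', x =
      ∑ j, (s j * LieModule.traceForm ℂ H 𝔤 (x : H) (v j : H)) • v j := by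
  let B : LinearMap.BilinForm ℂ (leviCartan R') :=
    (LieModule.traceForm ℂ H 𝔤).restrict (leviCartan R')
  have hB : LinearMap.IsSymm B := ⟨fun x y ↦ LieModule.traceForm_comm ℂ H 𝔤 x y⟩
  obtain ⟨v, hv⟩ := LinearMap.BilinForm.exists_orthogonal_basis hB
  have hvv : ∀ j, B (v j) (v j) ≠ 0 := by
    intro j h0
    refine v.ne_zero j (Subtype.ext (eq_zero_of_traceForm_leviCartan_eq_zero (v j).2 ?_))
    suffices h : B (v j) = 0 from fun y hy ↦ LinearMap.congr_fun h ⟨y, hy⟩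
    refine v.ext fun i ↦ ?_
    rw [LinearMap.zero_apply]
    by_cases hij : j = i
    · rw [← hij, h0]
    · exact hv hij
  refine ⟨_, v, fun j ↦ (B (v j) (v j))⁻¹, fun x ↦ ?_⟩
  have key : (LinearMap.id : leviCartan R' →ₗ[ℂ] leviCartan R') =
      ∑ j, ((B (v j) (v j))⁻¹ • B.flip (v j)).smulRight (v j) := by
    refine v.ext fun i ↦ ?_
    rw [LinearMap.sum_apply, Finset.sum_eq_single i]
    · simp [hvv i]
    · intro j _ hji
      have : B (v i) (v j) = 0 := hv hji.symm
      simp [this]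
    · simp
  have := LinearMap.congr_fun key x
  rw [LinearMap.id_apply, LinearMap.sum_apply] at this
  exact this

end ClosedRoots

/-! ### Simple roots of a closed set of roots -/

section SimpleRoots

variable {𝔤 : Type*} [LieRing 𝔤] [LieAlgebra ℂ 𝔤] [FiniteDimensional ℂ 𝔤] [LieAlgebra.IsSimple ℂ 𝔤]
  {H : LieSubalgebra ℂ 𝔤} [H.IsCartanSubalgebra]
  (b : (rootSystem H).Base) (R' : ClosedRootSet H)

variable {b} in
theorem isPos_reflectionPerm_self {α : H.root} (hα : ¬ b.IsPos α) :
    b.IsPos ((rootSystem H).reflectionPerm α α) :=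
  (RootPairing.Base.IsPos.or_neg b α).resolve_left hα

variable {b R'} in
theorem pairingIn_nonpos_of_leviSimple {β δ : H.root} (hβ : β ∈ leviSimpleRoots b R')
    (hδ : δ ∈ leviSimpleRoots b R') (hne : β ≠ δ) : (rootSystem H).pairingIn ℤ β δ ≤ 0 := by
  by_contra! hpos
  obtain ⟨ε, hε⟩ := (rootSystem H).root_sub_root_mem_of_pairingIn_pos hpos hne
  have hεR : ε ∈ R'.roots := R'.add_mem β hβ.1.1 _
    (ClosedRootSet.reflectionPerm_self_mem hδ.1.1) ε (by
      rw [hε, root_reflectionPerm_self, sub_eq_add_neg])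
  by_cases hp : b.IsPos ε
  · exact hβ.2 ⟨ε, ⟨hεR, hp⟩, δ, hδ.1, by rw [hε, sub_add_cancel]⟩
  · exact hδ.2 ⟨β, hβ.1, _, ⟨ClosedRootSet.reflectionPerm_self_mem hεR,
      isPos_reflectionPerm_self hp⟩, by rw [root_reflectionPerm_self, hε]; abel⟩

variable {b R'} in
/-- By induction on the height: coroots are not additive, but the elements of `𝔥` dual to the roots
are, and they are proportional to the coroots. -/
theorem coroot_mem_span_leviSimple {α : H.root} (hα : α ∈ leviPosRoots b R') :
    coroot α.1 ∈ Submodule.span ℂ ((rootSystem H).coroot '' leviSimpleRoots b R') := by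
  set S := Submodule.span ℂ ((rootSystem H).coroot '' leviSimpleRoots b R')
  have hiff : ∀ γ : H.root, coroot γ.1 ∈ S ↔
      (cartanEquivDual H).symm ((rootSystem H).root γ) ∈ S := by
    intro γ
    obtain ⟨r, hr, hr'⟩ := exists_pos_smul_coroot γ
    rw [hr', S.smul_mem_iff (by exact_mod_cast hr.ne')]
  induction hn : (b.height α).toNat using Nat.strong_induction_on generalizing α with
  | _ n ih =>
  by_cases hs : α ∈ leviSimpleRoots b R'
  · exact Submodule.subset_span ⟨α, hs, rfl⟩
  have hdec : ∃ γ ∈ leviPosRoots b R', ∃ δ ∈ leviPosRoots b R',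
      (rootSystem H).root α = (rootSystem H).root γ + (rootSystem H).root δ := by
    by_contra h
    exact hs ⟨hα, h⟩
  obtain ⟨γ, hγ, δ, hδ, h⟩ := hdec
  have h1 := b.height_add h
  have h2 : 0 < b.height γ := hγ.2
  have h3 : 0 < b.height δ := hδ.2
  rw [hiff, h, map_add]
  exact add_mem ((hiff γ).mp (ih _ (by omega) hγ rfl)) ((hiff δ).mp (ih _ (by omega) hδ rfl))

theorem span_range_leviCoroot :
    Submodule.span ℂ (Set.range (leviCoroot : leviSimpleRoots b R' → leviCartan R')) = ⊤ := by
  apply Submodule.map_injective_of_injective (leviCartan R').injective_subtype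
  rw [Submodule.map_span, Submodule.map_top, Submodule.range_subtype, ← Set.range_comp]
  have : Set.range ((leviCartan R').subtype ∘ (leviCoroot : leviSimpleRoots b R' → leviCartan R')) =
      (rootSystem H).coroot '' leviSimpleRoots b R' := by
    rw [Set.image_eq_range]
    rfl
  rw [this]
  refine le_antisymm (Submodule.span_mono (Set.image_mono fun β hβ ↦ hβ.1.1))
    (Submodule.span_le.mpr ?_)
  rintro _ ⟨α, hα, rfl⟩
  by_cases hp : b.IsPos α
  · exact coroot_mem_span_leviSimple ⟨hα, hp⟩
  · have h := coroot_mem_span_leviSimple (b := b) (R' := R')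
      ⟨ClosedRootSet.reflectionPerm_self_mem hα, isPos_reflectionPerm_self hp⟩
    have h2 : (rootSystem H).coroot ((rootSystem H).reflectionPerm α α) =
        -(rootSystem H).coroot α := by
      rw [RootPairing.coroot_reflectionPerm, RootPairing.coreflection_apply_self]
    have h3 : (rootSystem H).coroot α =
        -(rootSystem H).coroot ((rootSystem H).reflectionPerm α α) := by rw [h2, neg_neg]
    rw [h3]
    exact neg_mem h

/-- The coroots of the simple roots of `R'` are linearly independent: they are pairwise obtuse, and
they lie in an open half space. -/
theorem linearIndependent_leviCoroot :
    LinearIndependent ℂ (leviCoroot : leviSimpleRoots b R' → leviCartan R') := by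
  classical
  have : Fintype (leviPosRoots b R') := Fintype.ofFinite _
  have : Fintype (leviSimpleRoots b R') := Fintype.ofFinite _
  -- the real span of the coroots embeds into `ℝ^R` by the values of the roots, and the standard
  -- inner product restricts to the Killing form
  let v : leviSimpleRoots b R' → H.root → ℝ := fun β γ ↦ (rootSystem H).pairingIn ℤ γ β.1
  let B : LinearMap.BilinForm ℝ (H.root → ℝ) :=
    ∑ γ, (LinearMap.proj γ).smulRight (LinearMap.proj γ : (H.root → ℝ) →ₗ[ℝ] ℝ)
  have hB : ∀ x y, B x y = ∑ γ, x γ * y γ := fun x y ↦ by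
    rw [LinearMap.sum_apply, LinearMap.sum_apply]
    rfl
  have hpos : LinearMap.BilinMap.toQuadraticMap B |>.PosDef := by
    intro x hx
    rw [LinearMap.BilinMap.toQuadraticMap_apply, hB]
    obtain ⟨γ, hγ⟩ := Function.ne_iff.mp hx
    exact Finset.sum_pos' (fun _ _ ↦ mul_self_nonneg _)
      ⟨γ, Finset.mem_univ _, mul_self_pos.mpr hγ⟩
  let f : Dual ℝ (H.root → ℝ) := ∑ γ : leviPosRoots b R', LinearMap.proj γ.1
  have hf : ∀ β, 0 < f (v β) := by
    intro β
    have h := sum_pairingIn_pos β.2.1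
    rw [LinearMap.sum_apply]
    simp only [LinearMap.proj_apply, v]
    exact_mod_cast h
  have hneg : Pairwise fun β δ ↦ B (v β) (v δ) ≤ 0 := by
    intro β δ hne
    obtain ⟨r, hr, hr'⟩ := exists_pos_smul_coroot β.1
    have h1 : (r : ℂ) * LieModule.traceForm ℂ H 𝔤 (coroot β.1.1) (coroot δ.1.1) =
        β.1.1 (coroot δ.1.1) := by
      rw [← smul_eq_mul, ← LinearMap.smul_apply, ← map_smul, ← hr']
      exact LinearMap.congr_fun ((cartanEquivDual H).apply_symm_apply _) _
    rw [traceForm_eq_sum] at h1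
    simp only [apply_coroot_eq_pairingIn] at h1
    have h2 : r * B (v β) (v δ) = (rootSystem H).pairingIn ℤ β.1 δ.1 := by
      rw [hB]
      simp only [v]
      exact_mod_cast h1
    have h3 : ((rootSystem H).pairingIn ℤ β.1 δ.1 : ℝ) ≤ 0 := by
      exact_mod_cast pairingIn_nonpos_of_leviSimple β.2 δ.2 fun h ↦ hne (Subtype.ext h)
    by_contra! h
    nlinarith [mul_pos hr h]
  have hv : LinearIndependent ℝ v :=
    LinearMap.BilinForm.linearIndependent_of_pairwise_le_zero B hpos f v hf hneg
  rw [Fintype.linearIndependent_iff] at hv ⊢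
  intro c hc
  have hγ : ∀ γ : H.root, ∑ β, c β * ((rootSystem H).pairingIn ℤ γ β.1 : ℂ) = 0 := by
    intro γ
    have := congrArg (fun x : leviCartan R' ↦ (rootSystem H).root γ (x : H)) hc
    simpa [leviCoroot, apply_coroot_eq_pairingIn, - LieModule.Weight.toLinear_apply,
      LieModule.Weight.toLinear_apply ℂ] using this
  intro β
  refine Complex.ext (hv (fun β ↦ (c β).re) ?_ β) (hv (fun β ↦ (c β).im) ?_ β)
  · funext γ
    simpa [v] using congrArg Complex.re (hγ γ)
  · funext γ
    simpa [v] using congrArg Complex.im (hγ γ)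

/-- The basis of `𝔥_𝔞` consisting of the coroots of the simple roots of `𝔞`. -/
def leviCorootBasis : Basis (leviSimpleRoots b R') ℂ (leviCartan R') :=
  Basis.mk (linearIndependent_leviCoroot b R') (span_range_leviCoroot b R').ge

@[simp]
theorem leviCorootBasis_apply (β : leviSimpleRoots b R') : leviCorootBasis b R' β = leviCoroot β :=
  Basis.mk_apply _ _ β

/-- The fundamental weight of `𝔞` attached to the simple root `β`. -/
def leviFundamentalWeight (β : leviSimpleRoots b R') : Dual ℂ (leviCartan R') :=
  (leviCorootBasis b R').coord β

theorem leviFundamentalWeight_apply [DecidableEq (leviSimpleRoots b R')]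
    (β γ : leviSimpleRoots b R') :
    leviFundamentalWeight b R' β (leviCoroot γ) = if γ = β then 1 else 0 := by
  rw [← leviCorootBasis_apply, leviFundamentalWeight, Basis.coord_apply, Basis.repr_self,
    Finsupp.single_apply]

theorem isLeviFundamentalWeight_leviFundamentalWeight (β : leviSimpleRoots b R') :
    IsLeviFundamentalWeight b R' β (leviFundamentalWeight b R' β) := by
  classical
  exact ⟨by simp [leviFundamentalWeight_apply],
    fun γ hγ ↦ by simp [leviFundamentalWeight_apply, hγ]⟩

variable {b R'} in
theorem levi_dual_ext {μ ν : Dual ℂ (leviCartan R')}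
    (h : ∀ β : leviSimpleRoots b R', μ (leviCoroot β) = ν (leviCoroot β)) : μ = ν :=
  (leviCorootBasis b R').ext fun β ↦ by simpa using h β

theorem leviFundamentalWeight_mem (β : leviSimpleRoots b R') :
    leviFundamentalWeight b R' β ∈ leviDominantWeights b R' := by
  classical
  intro γ
  rw [leviFundamentalWeight_apply]
  split_ifs
  exacts [⟨1, by simp⟩, ⟨0, by simp⟩]

end SimpleRoots

/-! ### Lifting finitely supported functions -/

theorem wt_add {Q : Type*} [AddCommMonoid Q] (ψ ψ' : ℂ →₀ Q) : wt (ψ + ψ') = wt ψ + wt ψ' :=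
  Finsupp.sum_add_index' (fun _ ↦ rfl) fun _ _ _ ↦ rfl

theorem wt_single {Q : Type*} [AddCommMonoid Q] (c : ℂ) (q : Q) : wt (Finsupp.single c q) = q :=
  Finsupp.sum_single_index rfl

section Lifting

variable {𝔤 : Type*} [LieRing 𝔤] [LieAlgebra ℂ 𝔤] [FiniteDimensional ℂ 𝔤] [LieAlgebra.IsSimple ℂ 𝔤]
  {H : LieSubalgebra ℂ 𝔤} [H.IsCartanSubalgebra]
  {b : (rootSystem H).Base} {R' : ClosedRootSet H}

theorem fundamentalWeight_apply [DecidableEq b.support] (i j : b.support) :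
    fundamentalWeight b i ((rootSystem H).coroot j) = if j = i then 1 else 0 := by
  rw [fundamentalWeight, Basis.coord_apply, b.toCoweightBasis_repr_coroot, Finsupp.single_apply]

theorem dual_ext {μ ν : Dual ℂ H}
    (h : ∀ i : b.support, μ ((rootSystem H).coroot i) = ν ((rootSystem H).coroot i)) : μ = ν :=
  b.toCoweightBasis.ext fun i ↦ by simpa using h i

/-- A dominant weight with a nonzero value at the `i`-th simple coroot remains dominant after
subtracting `ω_i`. -/
theorem sub_fundamentalWeight_mem {μ : Dual ℂ H} (hμ : μ ∈ dominantWeights b) {i : b.support}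
    (hi : μ ((rootSystem H).coroot i) ≠ 0) : μ - fundamentalWeight b i ∈ dominantWeights b := by
  classical
  intro j hj
  obtain ⟨m, hm⟩ := hμ j hj
  have h := fundamentalWeight_apply i ⟨j, hj⟩
  rw [LinearMap.sub_apply, hm, h]
  split_ifs with hji
  · subst hji
    have : m ≠ 0 := by rintro rfl; exact hi (by simpa using hm)
    exact ⟨m - 1, by rw [Nat.cast_sub (Nat.one_le_iff_ne_zero.mpr this), Nat.cast_one]⟩
  · exact ⟨m, sub_zero _⟩

theorem fundamentalWeight_mem (i : b.support) : fundamentalWeight b i ∈ dominantWeights b := by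
  classical
  intro j hj
  rw [fundamentalWeight_apply i ⟨j, hj⟩]
  split_ifs
  exacts [⟨1, by simp⟩, ⟨0, by simp⟩]

theorem sub_levi_mem {μ τ : Dual ℂ (leviCartan R')} (hμ : μ ∈ leviDominantWeights b R')
    {β : leviSimpleRoots b R'} (hτ : IsLeviFundamentalWeight b R' β τ) (hβ : μ (leviCoroot β) ≠ 0) :
    μ - τ ∈ leviDominantWeights b R' := by
  intro γ
  obtain ⟨m, hm⟩ := hμ γ
  rw [LinearMap.sub_apply]
  by_cases hγ : γ = β
  · subst hγ
    have : m ≠ 0 := by rintro rfl; exact hβ (by simpa using hm)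
    exact ⟨m - 1, by rw [hm, hτ.1, Nat.cast_sub (Nat.one_le_iff_ne_zero.mpr this), Nat.cast_one]⟩
  · exact ⟨m, by rw [hτ.2 γ hγ, sub_zero, hm]⟩

theorem wt_apply_leviCoroot (φ : ℂ →₀ leviDominantWeights b R') (β : leviSimpleRoots b R') :
    (wt φ).1 (leviCoroot β) = ∑ c ∈ φ.support, (φ c).1 (leviCoroot β) := by
  rw [wt, Finsupp.sum, AddSubmonoid.coe_finsetSum, LinearMap.sum_apply]

theorem wt_apply_coroot (ψ : ℂ →₀ dominantWeights b) (i : b.support) :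
    (wt ψ).1 ((rootSystem H).coroot i) = ∑ c ∈ ψ.support, (ψ c).1 ((rootSystem H).coroot i) := by
  rw [wt, Finsupp.sum, AddSubmonoid.coe_finsetSum, LinearMap.sum_apply]

/-- A finitely supported function with values in `P⁺_𝔞` and weight zero vanishes. -/
theorem eq_zero_of_wt_eq_zero {φ : ℂ →₀ leviDominantWeights b R'} (h : wt φ = 0) : φ = 0 := by
  ext1 c
  by_contra hc
  refine hc (Subtype.ext (levi_dual_ext (b := b) fun β ↦ ?_))
  have h1 := wt_apply_leviCoroot φ β
  choose m hm using fun c ↦ (φ c).2 β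
  simp only [h, hm] at h1
  have h2 : ∑ c ∈ φ.support, m c = 0 := by
    have : ((∑ c ∈ φ.support, m c : ℕ) : ℂ) = 0 := by
      push_cast
      rw [← h1]
      simp
    exact_mod_cast this
  rw [hm, Finset.sum_eq_zero_iff.mp h2 c (Finsupp.mem_support_iff.mpr hc)]
  simp

/-- If `(𝔞, λ)` is globally admissible, every `φ` of weight `π(λ)` lifts: peel off the fundamental
weights `ω_i` from `λ` one at a time, together with `π(ω_i)` from a value of `φ`. -/
theorem exists_lift (n : ℕ) (lam : dominantWeights b)
    (hn : ∑ i : b.support, lam.1 ((rootSystem H).coroot i) = n)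
    (hadm : GloballyAdmissible b R' lam) (φ : ℂ →₀ leviDominantWeights b R')
    (hφ : wt φ = resDominant b R' lam) :
    ∃ ψ : ℂ →₀ dominantWeights b, wt ψ = lam ∧
      ψ.mapRange (resDominant b R') (map_zero _) = φ := by
  classical
  induction n generalizing lam φ with
  | zero =>
    have hlam : lam = 0 := by
      refine Subtype.ext (dual_ext (b := b) fun i ↦ ?_)
      choose m hm using fun i : b.support ↦ lam.2 i i.2
      simp only [hm] at hn
      have h2 : ∑ i : b.support, m i = 0 := by exact_mod_cast hn
      rw [hm, Finset.sum_eq_zero_iff.mp h2 i (Finset.mem_univ _)]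
      simp
    subst hlam
    rw [map_zero] at hφ
    refine ⟨0, Finsupp.sum_zero_index, ?_⟩
    rw [eq_zero_of_wt_eq_zero hφ, Finsupp.mapRange_zero]
  | succ n ih =>
    obtain ⟨i, hi⟩ : ∃ i : b.support, lam.1 ((rootSystem H).coroot i) ≠ 0 := by
      by_contra! h
      simp only [h, Finset.sum_const_zero] at hn
      exact Nat.cast_ne_zero.mpr (Nat.succ_ne_zero n) hn.symm
    let ω : dominantWeights b := ⟨fundamentalWeight b i, fundamentalWeight_mem i⟩
    let lam' : dominantWeights b :=
      ⟨lam.1 - fundamentalWeight b i, sub_fundamentalWeight_mem lam.2 hi⟩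
    have hlam : lam = lam' + ω := Subtype.ext (sub_add_cancel _ _).symm
    have hlam' : ∀ j : b.support, lam'.1 ((rootSystem H).coroot j) =
        lam.1 ((rootSystem H).coroot j) - if j = i then 1 else 0 := by
      intro j
      rw [← fundamentalWeight_apply i j, ← LinearMap.sub_apply]
    have hn' : ∑ j : b.support, lam'.1 ((rootSystem H).coroot j) = n := by
      simp only [hlam', Finset.sum_sub_distrib, hn]
      simp
    have hadm' : GloballyAdmissible b R' lam' := by
      intro j hj
      refine hadm j fun h0 ↦ hj ?_
      rw [hlam', h0]
      have : j ≠ i := by rintro rfl; exact hi h0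
      simp [this]
    rcases hadm i hi with h0 | ⟨β, hβ⟩
    · have h0' : resDominant b R' ω = 0 := Subtype.ext h0
      obtain ⟨ψ, hψ, hψφ⟩ := ih lam' hn' hadm' φ (by rw [hφ, hlam, map_add, h0', add_zero])
      refine ⟨ψ + Finsupp.single 0 ω, by rw [wt_add, wt_single, hψ, hlam], ?_⟩
      rw [Finsupp.mapRange_add (map_add _), Finsupp.mapRange_single, h0', Finsupp.single_zero,
        add_zero, hψφ]
    · let τ : leviDominantWeights b R' := resDominant b R' ω
      have hτ : IsLeviFundamentalWeight b R' β τ.1 := hβ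
      obtain ⟨c, hc⟩ : ∃ c, (φ c).1 (leviCoroot β) ≠ 0 := by
        by_contra! h
        have h1 := wt_apply_leviCoroot φ β
        simp only [h, Finset.sum_const_zero] at h1
        obtain ⟨m, hm⟩ := (resDominant b R' lam').2 β
        rw [hφ, hlam, map_add, AddSubmonoid.coe_add, LinearMap.add_apply, hm, hτ.1] at h1
        exact Nat.cast_add_one_ne_zero m h1
      let φ' : ℂ →₀ leviDominantWeights b R' :=
        φ.update c ⟨(φ c).1 - τ.1, sub_levi_mem (φ c).2 hτ hc⟩
      have hφ' : φ = φ' + Finsupp.single c τ := by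
        ext1 d
        by_cases hd : d = c
        · subst hd
          refine Subtype.ext ?_
          simp [φ']
        · simp [φ', hd]
      obtain ⟨ψ, hψ, hψφ⟩ := ih lam' hn' hadm' φ' (by
        rw [hφ', wt_add, wt_single, hlam, map_add] at hφ
        exact add_right_cancel hφ)
      refine ⟨ψ + Finsupp.single c ω, by rw [wt_add, wt_single, hψ, hlam], ?_⟩
      rw [Finsupp.mapRange_add (map_add _), Finsupp.mapRange_single, hψφ]
      exact hφ'.symm

theorem GloballyAdmissible.surjective_resFun {lam : dominantWeights b}
    (hadm : GloballyAdmissible b R' lam) : Function.Surjective (resFun b R' lam) := by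
  rintro ⟨φ, hφ⟩
  choose m hm using fun i : b.support ↦ lam.2 i i.2
  obtain ⟨ψ, hψ, hψφ⟩ := exists_lift (∑ i, m i) lam (by simp only [hm]; push_cast; rfl) hadm φ hφ
  exact ⟨⟨ψ, hψ⟩, Subtype.ext hψφ⟩

/-- Every `μ ∈ P⁺_𝔞` is the weight of a function all of whose nonzero values are fundamental
weights of `𝔞`. -/
theorem exists_wt_eq_fundamental (n : ℕ) (μ : leviDominantWeights b R')
    [Fintype (leviSimpleRoots b R')]
    (hn : ∑ β : leviSimpleRoots b R', μ.1 (leviCoroot β) = n) :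
    ∃ φ : ℂ →₀ leviDominantWeights b R', wt φ = μ ∧
      ∀ c, φ c = 0 ∨ ∃ β, (φ c).1 = leviFundamentalWeight b R' β := by
  classical
  induction n generalizing μ with
  | zero =>
    refine ⟨0, ?_, fun c ↦ Or.inl rfl⟩
    refine Finsupp.sum_zero_index.trans (Subtype.ext (levi_dual_ext (b := b) fun β ↦ ?_))
    choose m hm using μ.2
    simp only [hm] at hn
    have h2 : ∑ β, m β = 0 := by exact_mod_cast hn
    rw [hm, Finset.sum_eq_zero_iff.mp h2 β (Finset.mem_univ _)]
    simp
  | succ n ih =>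
    obtain ⟨β, hβ⟩ : ∃ β : leviSimpleRoots b R', μ.1 (leviCoroot β) ≠ 0 := by
      by_contra! h
      simp only [h, Finset.sum_const_zero] at hn
      exact Nat.cast_ne_zero.mpr (Nat.succ_ne_zero n) hn.symm
    let τ : leviDominantWeights b R' :=
      ⟨leviFundamentalWeight b R' β, leviFundamentalWeight_mem b R' β⟩
    let μ' : leviDominantWeights b R' := ⟨μ.1 - leviFundamentalWeight b R' β,
      sub_levi_mem μ.2 (isLeviFundamentalWeight_leviFundamentalWeight b R' β) hβ⟩
    have hμ : μ' + τ = μ := Subtype.ext (sub_add_cancel _ _)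
    have hn' : ∑ γ : leviSimpleRoots b R', μ'.1 (leviCoroot γ) = n := by
      simp only [μ', LinearMap.sub_apply, leviFundamentalWeight_apply, Finset.sum_sub_distrib, hn]
      simp
    obtain ⟨φ, hφ, hφ'⟩ := ih μ' hn'
    obtain ⟨c, hc⟩ := Infinite.exists_notMem_finset φ.support
    refine ⟨φ + Finsupp.single c τ, by rw [wt_add, wt_single, hφ, hμ], fun d ↦ ?_⟩
    by_cases hd : d = c
    · subst hd
      exact Or.inr ⟨β, by simp [Finsupp.notMem_support_iff.mp hc, τ]⟩
    · simpa [Finsupp.single_apply, Ne.symm hd] using hφ' d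

/-- If `π(ω_i)` is neither zero nor fundamental for some `ω_i` occurring in `λ`, then a function all
of whose nonzero values are fundamental weights of `𝔞` does not lift. -/
theorem globallyAdmissible_of_surjective {lam : dominantWeights b}
    (h : Function.Surjective (resFun b R' lam)) : GloballyAdmissible b R' lam := by
  classical
  have : Fintype (leviSimpleRoots b R') := Fintype.ofFinite _
  intro i hi
  choose m hm using (resDominant b R' lam).2
  -- at a point `c` where the lift has positive `ω_i`-coefficient, `φ c` is the sum of `π(ω_i)` and
  -- of another dominant weight
  obtain ⟨φ, hφ, hφ'⟩ := exists_wt_eq_fundamental (∑ β, m β) (resDominant b R' lam)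
    (by simp only [hm]; push_cast; rfl)
  obtain ⟨⟨ψ, hψ⟩, hψφ⟩ := h ⟨φ, hφ⟩
  replace hψφ : ψ.mapRange (resDominant b R') (map_zero _) = φ := congrArg Subtype.val hψφ
  obtain ⟨c, hc⟩ : ∃ c, (ψ c).1 ((rootSystem H).coroot i) ≠ 0 := by
    by_contra! h0
    have h1 := wt_apply_coroot ψ i
    simp only [h0, Finset.sum_const_zero, hψ] at h1
    exact hi h1
  have hrest := res_mem b R' (sub_fundamentalWeight_mem (ψ c).2 hc)
  have hω := res_mem b R' (fundamentalWeight_mem i)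
  have hφc : (φ c).1 = res R' (fundamentalWeight b i) +
      res R' ((ψ c).1 - fundamentalWeight b i) := by
    rw [← hψφ, ← map_add, add_sub_cancel]
    rfl
  choose p hp using hω
  choose q hq using hrest
  have hval : ∀ γ, (φ c).1 (leviCoroot γ) = ((p γ + q γ : ℕ) : ℂ) := by
    intro γ
    rw [hφc, LinearMap.add_apply, hp, hq, Nat.cast_add]
  by_cases hzero : ∀ γ, p γ = 0
  · exact Or.inl (levi_dual_ext (b := b) fun γ ↦ by rw [hp, hzero γ]; simp)
  · push Not at hzero
    obtain ⟨γ₀, hγ₀⟩ := hzero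
    rcases hφ' c with h0 | ⟨β, hβ⟩
    · have h1 := hval γ₀
      rw [h0] at h1
      have : p γ₀ + q γ₀ = 0 := by
        rw [ZeroMemClass.coe_zero, LinearMap.zero_apply] at h1
        exact_mod_cast h1.symm
      omega
    · have hle : ∀ γ, p γ + q γ = if γ = β then 1 else 0 := by
        intro γ
        have h1 := hval γ
        rw [hβ, leviFundamentalWeight_apply] at h1
        exact_mod_cast h1.symm
      have hγβ : γ₀ = β := by
        by_contra hne
        have := hle γ₀
        rw [if_neg hne] at this
        omega
      subst hγβ
      refine Or.inr ⟨γ₀, ?_, fun γ hγ ↦ ?_⟩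
      · have := hle γ₀
        rw [if_pos rfl] at this
        have h1 : p γ₀ = 1 := by omega
        rw [hp, h1, Nat.cast_one]
      · have := hle γ
        rw [if_neg hγ] at this
        have h1 : p γ = 0 := by omega
        rw [hp, h1, Nat.cast_zero]

end Lifting

/-! ### The triangular decomposition of a Levi subalgebra -/

section LeviStructure

variable {𝔤 : Type*} [LieRing 𝔤] [LieAlgebra ℂ 𝔤] [FiniteDimensional ℂ 𝔤] [LieAlgebra.IsSimple ℂ 𝔤]
  {H : LieSubalgebra ℂ 𝔤} [H.IsCartanSubalgebra]
  (b : (rootSystem H).Base) (R' : ClosedRootSet H)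

variable {R'} in
theorem mem_levi_of_mem_rootSpace {α : H.root} (hα : α ∈ R'.roots) {x : 𝔤}
    (hx : x ∈ rootSpace H α.1) : x ∈ levi R' :=
  LieSubalgebra.subset_lieSpan (Set.mem_biUnion hα hx)

/-- The elements of `𝔥_𝔞` and of the root spaces `𝔤_α`, `α ∈ R'`. -/
def leviGenerators : Set 𝔤 :=
  {x | ∃ h ∈ leviCartan R', (h : 𝔤) = x} ∪ {x | ∃ α ∈ R'.roots, x ∈ rootSpace H α.1}

/-- `𝔥_𝔞 + ∑_{α ∈ R'} 𝔤_α` is closed under the bracket, hence it is all of `𝔞`. -/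
theorem levi_le_span_leviGenerators :
    (levi R').toSubmodule ≤ Submodule.span ℂ (leviGenerators R') := by
  set T := Submodule.span ℂ (leviGenerators R') with hT
  have hgen : ∀ x ∈ leviGenerators R', ∀ y ∈ leviGenerators R', ⁅x, y⁆ ∈ T := by
    have hhe : ∀ h : H, ∀ α ∈ R'.roots, ∀ e ∈ rootSpace H α.1, ⁅(h : 𝔤), e⁆ ∈ T := by
      intro h α hα e he
      have : ⁅(h : 𝔤), e⁆ = α.1 h • e := lie_eq_smul_of_mem_rootSpace he h
      rw [this]
      exact T.smul_mem _ (Submodule.subset_span (Or.inr ⟨α, hα, he⟩))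
    rintro x (⟨h, hh, rfl⟩ | ⟨α, hα, hx⟩) y (⟨h', hh', rfl⟩ | ⟨β, hβ, hy⟩)
    · have : ⁅h, h'⁆ = 0 := trivial_lie_zero H H h h'
      have h0 : ⁅(h : 𝔤), (h' : 𝔤)⁆ = 0 := congrArg Subtype.val this
      rw [h0]
      exact zero_mem _
    · exact hhe h β hβ y hy
    · rw [← lie_skew]
      exact neg_mem (hhe h' α hα x hx)
    · have hxy : ⁅x, y⁆ ∈ rootSpace H (α.1 + β.1 : H → ℂ) :=
        lie_mem_genWeightSpace_of_mem_genWeightSpace hx hy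
      by_cases hbot : rootSpace H (α.1 + β.1 : H → ℂ) = ⊥
      · rw [hbot, LieSubmodule.mem_bot] at hxy
        rw [hxy]
        exact zero_mem _
      by_cases hzero : (α.1 + β.1 : H → ℂ) = 0
      · have hβα : (β.1 : H → ℂ) = -α.1 := by rw [eq_neg_iff_add_eq_zero, add_comm, hzero]
        rw [hβα] at hy
        rw [lie_eq_killingForm_smul_of_mem_rootSpace_of_mem_rootSpace_neg hx hy]
        refine T.smul_mem _ (Submodule.subset_span (Or.inl ⟨_, ?_, rfl⟩))
        obtain ⟨r, -, hr⟩ := exists_pos_smul_coroot α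
        rw [rootSystem_root_apply] at hr
        rw [hr]
        exact Submodule.smul_mem _ _ (Submodule.subset_span ⟨α, hα, rfl⟩)
      · let χ : LieModule.Weight ℂ H 𝔤 := ⟨α.1 + β.1, hbot⟩
        have hχ : χ ∈ H.root := by
          simp only [LieSubalgebra.root, Finset.mem_filter, Finset.mem_univ, true_and]
          exact hzero
        refine Submodule.subset_span (Or.inr ⟨⟨χ, hχ⟩, R'.add_mem α hα β hβ _ ?_, hxy⟩)
        ext t
        simp [χ]
  let K : LieSubalgebra ℂ 𝔤 :=
    { T with
      lie_mem' := by
        intro x y hx hy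
        induction hx, hy using Submodule.span_induction₂ with
        | mem_mem x y hx hy => exact hgen x hx y hy
        | zero_left y hy => rw [zero_lie]; exact T.zero_mem
        | zero_right x hx => rw [lie_zero]; exact T.zero_mem
        | add_left x y z _ _ _ h1 h2 => rw [add_lie]; exact T.add_mem h1 h2
        | add_right x y z _ _ _ h1 h2 => rw [lie_add]; exact T.add_mem h1 h2
        | smul_left c x y _ _ h => rw [smul_lie]; exact T.smul_mem c h
        | smul_right c x y _ _ h => rw [lie_smul]; exact T.smul_mem c h }
  have : levi R' ≤ K := by
    refine LieSubalgebra.lieSpan_le.mpr fun x hx ↦ ?_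
    obtain ⟨α, hα, hx⟩ := Set.mem_iUnion₂.mp hx
    exact Submodule.subset_span (Or.inr ⟨α, hα, hx⟩)
  exact this

omit [FiniteDimensional ℂ 𝔤] [LieAlgebra.IsSimple ℂ 𝔤] [H.IsCartanSubalgebra] in
theorem killingForm_coe (x y : H) :
    killingForm ℂ 𝔤 (x : 𝔤) (y : 𝔤) = LieModule.traceForm ℂ H 𝔤 x y :=
  LinearMap.congr_fun₂ (restrict_killingForm (R := ℂ) (L := 𝔤) H) x y

omit [LieAlgebra.IsSimple ℂ 𝔤] in
theorem killingForm_coe_rootSpace (h : H) (α : H.root) {x : 𝔤}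
    (hx : x ∈ rootSpace H α.1) : killingForm ℂ 𝔤 (h : 𝔤) x = 0 := by
  refine killingForm_apply_eq_zero_of_mem_rootSpace_of_add_ne_zero ℂ 𝔤 H
    (toLieSubmodule_le_rootSpace_zero ℂ 𝔤 H h.2) hx ?_
  rw [zero_add]
  exact fun h0 ↦ LieSubalgebra.isNonZero_coe_root α h0

variable {b} in
theorem add_ne_zero_of_isPos {α β : H.root} (hα : b.IsPos α) (hβ : b.IsPos β) :
    (α.1 + β.1 : H → ℂ) ≠ 0 := by
  intro h
  have h1 : (rootSystem H).root ((rootSystem H).reflectionPerm α α) = (rootSystem H).root β := by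
    rw [root_reflectionPerm_self]
    ext t
    have := congrFun h t
    simp only [Pi.add_apply, Pi.zero_apply] at this
    simp only [LinearMap.neg_apply, rootSystem_root_apply, LieModule.Weight.toLinear_apply]
    linear_combination -this
  rw [← (rootSystem H).root.injective h1] at hβ
  exact (RootPairing.Base.IsPos.neg_iff_not b α).mp hβ hα

omit [LieAlgebra.IsSimple ℂ 𝔤] in
theorem sub_ne_zero_of_ne {α β : H.root} (h : α ≠ β) : (α.1 + -β.1 : H → ℂ) ≠ 0 := fun h0 ↦
  h (Subtype.ext (DFunLike.coe_injective (by rwa [← sub_eq_add_neg, sub_eq_zero] at h0)))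

theorem eq_smul_of_mem_rootSpace {α : LieModule.Weight ℂ H 𝔤} (hα : α.IsNonZero) {x e : 𝔤}
    (he : e ∈ rootSpace H α) (he0 : e ≠ 0) (hx : x ∈ rootSpace H α) : ∃ c : ℂ, x = c • e := by
  obtain ⟨c, hc⟩ := (finrank_eq_one_iff_of_nonzero' (⟨e, he⟩ : rootSpace H α)
    (fun h ↦ he0 (congrArg Subtype.val h))).mp (finrank_rootSpace_eq_one α hα) ⟨x, hx⟩
  exact ⟨c, (congrArg Subtype.val hc).symm⟩

/-- The Levi subalgebra `𝔞` has a triangular decomposition with Cartan subalgebra `𝔥_𝔞` and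
invariant form the restriction of the Killing form of `𝔤`. -/
theorem exists_triangularData [Fintype (leviPosRoots b R')] :
    ∃ D : TriangularData (leviCartan R') (levi R') (leviPosRoots b R'),
    D.incl = leviCartanIncl R' ∧ ∀ α, D.e α ∈ leviNPos b R' := by
  have hnz : ∀ α : H.root, α.1.IsNonZero := fun α ↦ LieSubalgebra.isNonZero_coe_root α
  choose h e f hsl he hf using fun α : leviPosRoots b R' ↦
    exists_isSl2Triple_of_weight_isNonZero (hnz α.1)
  have hh : ∀ α, h α = coroot α.1.1 := fun α ↦
    IsSl2Triple.h_eq_coroot (hnz α.1) (hsl α) (he α) (hf α)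
  choose r hr hr' using fun α : leviPosRoots b R' ↦ exists_pos_smul_coroot α.1
  obtain ⟨n, v, s, hv⟩ := exists_orthogonal_leviCartan R'
  have hfneg : ∀ α : leviPosRoots b R', ∃ β ∈ R'.roots, β.1 = -α.1.1 := by
    intro α
    refine ⟨_, ClosedRootSet.reflectionPerm_self_mem α.2.1, ?_⟩
    ext t
    exact LinearMap.congr_fun (root_reflectionPerm_self α.1) t
  have heL : ∀ α, e α ∈ levi R' := fun α ↦ mem_levi_of_mem_rootSpace α.2.1 (he α)
  have hfL : ∀ α, f α ∈ levi R' := by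
    intro α
    obtain ⟨β, hβ, hβ'⟩ := hfneg α
    refine mem_levi_of_mem_rootSpace hβ ?_
    rw [hβ']
    exact hf α
  have hef : ∀ α, (r α : ℂ) * killingForm ℂ 𝔤 (e α) (f α) = 1 := by
    intro α
    have h1 := lie_eq_killingForm_smul_of_mem_rootSpace_of_mem_rootSpace_neg (he α) (hf α)
    have h2 := hr' α
    rw [rootSystem_root_apply] at h2
    rw [(hsl α).lie_e_f, hh, h2] at h1
    have h3 : (1 : ℂ) • coroot α.1.1 = (killingForm ℂ 𝔤 (e α) (f α) * r α) • coroot α.1.1 := by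
      rw [one_smul, mul_smul]
      exact Subtype.ext h1
    have h4 : coroot α.1.1 ≠ 0 := by rw [ne_eq, coroot_eq_zero_iff]; exact hnz α.1
    rw [mul_comm]
    exact (smul_left_injective ℂ h4 h3).symm
  have hee : ∀ α β, killingForm ℂ 𝔤 (e α) (e β) = 0 := fun α β ↦
    killingForm_apply_eq_zero_of_mem_rootSpace_of_add_ne_zero ℂ 𝔤 H (he α) (he β)
      (add_ne_zero_of_isPos α.2.2 β.2.2)
  have hff : ∀ α β, killingForm ℂ 𝔤 (f α) (f β) = 0 := fun α β ↦
    killingForm_apply_eq_zero_of_mem_rootSpace_of_add_ne_zero ℂ 𝔤 H (hf α) (hf β) (by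
      rw [← neg_add, neg_ne_zero]
      exact add_ne_zero_of_isPos α.2.2 β.2.2)
  have hef' : ∀ α β, α ≠ β → killingForm ℂ 𝔤 (e α) (f β) = 0 := fun α β hne ↦
    killingForm_apply_eq_zero_of_mem_rootSpace_of_add_ne_zero ℂ 𝔤 H (he α) (hf β)
      (sub_ne_zero_of_ne fun h ↦ hne (Subtype.ext h))
  have hsymm : ∀ x y, killingForm ℂ 𝔤 x y = killingForm ℂ 𝔤 y x := LieModule.traceForm_comm ℂ 𝔤 𝔤
  have hhe : ∀ (t : H) α, killingForm ℂ 𝔤 (t : 𝔤) (e α) = 0 := fun t α ↦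
    killingForm_coe_rootSpace t α.1 (he α)
  have hhf : ∀ (t : H) α, killingForm ℂ 𝔤 (t : 𝔤) (f α) = 0 := by
    intro t α
    obtain ⟨β, -, hβ⟩ := hfneg α
    exact killingForm_coe_rootSpace t β (by rw [hβ]; exact hf α)
  -- the expansion of an element of `𝔞` in the dual bases need only be checked on generators
  let E : 𝔤 →ₗ[ℂ] 𝔤 := ∑ j, (s j • (killingForm ℂ 𝔤).flip (v j : H)).smulRight ((v j : H) : 𝔤) +
    (∑ α, ((r α : ℂ) • (killingForm ℂ 𝔤).flip (f α)).smulRight (e α) +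
      ∑ α, ((r α : ℂ) • (killingForm ℂ 𝔤).flip (e α)).smulRight (f α))
  have hE : ∀ z, E z = ∑ j, (s j * killingForm ℂ 𝔤 z ((v j : H) : 𝔤)) • ((v j : H) : 𝔤) +
      (∑ α, ((r α : ℂ) * killingForm ℂ 𝔤 z (f α)) • e α +
        ∑ α, ((r α : ℂ) * killingForm ℂ 𝔤 z (e α)) • f α) := by
    intro z
    simp [E, LinearMap.sum_apply]
  have hEe : ∀ α, E (e α) = e α := by
    intro α
    rw [hE, Finset.sum_eq_zero, zero_add, Finset.sum_eq_single α, hef, one_smul,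
      Finset.sum_eq_zero, add_zero]
    · intro β _
      rw [hee, mul_zero, zero_smul]
    · intro β _ hne
      rw [hef' α β hne.symm, mul_zero, zero_smul]
    · simp
    · intro j _
      rw [hsymm, hhe, mul_zero, zero_smul]
  have hEf : ∀ α, E (f α) = f α := by
    intro α
    rw [hE, Finset.sum_eq_zero, zero_add, Finset.sum_eq_zero, zero_add, Finset.sum_eq_single α,
      hsymm, hef, one_smul]
    · intro β _ hne
      rw [hsymm, hef' β α hne, mul_zero, zero_smul]
    · simp
    · intro β _
      rw [hff, mul_zero, zero_smul]
    · intro j _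
      rw [hsymm, hhf, mul_zero, zero_smul]
  have hEh : ∀ t ∈ leviCartan R', E (t : 𝔤) = t := by
    intro t ht
    have h1 := congrArg (H.toSubmodule.subtype ∘ₗ (leviCartan R').subtype) (hv ⟨t, ht⟩)
    rw [map_sum] at h1
    simp only [map_smul] at h1
    rw [hE, Finset.sum_eq_zero (s := Finset.univ) (f := fun α ↦ _ • e α),
      Finset.sum_eq_zero (s := Finset.univ) (f := fun α ↦ _ • f α), add_zero, add_zero]
    · simp only [killingForm_coe]
      exact h1.symm
    · intro α _
      rw [hhe, mul_zero, zero_smul]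
    · intro α _
      rw [hhf, mul_zero, zero_smul]
  have hexp : ∀ z ∈ levi R', E z = z := by
    intro z hz
    have hle : Submodule.span ℂ (leviGenerators R') ≤ LinearMap.eqLocus E LinearMap.id := by
      refine Submodule.span_le.mpr ?_
      rintro x (⟨t, ht, rfl⟩ | ⟨α, hα, hx⟩)
      · exact hEh t ht
      by_cases hp : b.IsPos α
      · obtain ⟨c, rfl⟩ := eq_smul_of_mem_rootSpace (hnz α) (he ⟨α, hα, hp⟩)
          (hsl ⟨α, hα, hp⟩).e_ne_zero hx
        change E _ = _
        rw [map_smul, hEe]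
        rfl
      · let β : leviPosRoots b R' := ⟨_, ClosedRootSet.reflectionPerm_self_mem hα,
          isPos_reflectionPerm_self hp⟩
        have hβ : -β.1.1 = α.1 := by
          ext t
          have := LinearMap.congr_fun (root_reflectionPerm_self α) t
          change -(β.1.1 t) = α.1 t
          rw [neg_eq_iff_eq_neg]
          exact this
        have hfβ := hf β
        rw [← LieModule.Weight.coe_neg, hβ] at hfβ
        obtain ⟨c, rfl⟩ := eq_smul_of_mem_rootSpace (hnz α) hfβ (hsl β).f_ne_zero hx
        change E _ = _
        rw [map_smul, hEf]
        rfl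
    exact hle (levi_le_span_leviGenerators R' hz)
  have hcor : ∀ α : leviPosRoots b R', coroot α.1.1 ∈ leviCartan R' := fun α ↦
    Submodule.subset_span ⟨α.1, α.2.1, rfl⟩
  have htrace : ∀ (α : leviPosRoots b R') (x : H),
      (r α : ℂ) * LieModule.traceForm ℂ H 𝔤 (coroot α.1.1) x = α.1.1 x := by
    intro α x
    rw [← smul_eq_mul, ← LinearMap.smul_apply, ← map_smul, ← hr']
    exact LinearMap.congr_fun ((cartanEquivDual H).apply_symm_apply _) _
  refine ⟨{
    incl := leviCartanIncl R'
    root := fun α ↦ res R' ((rootSystem H).root α.1)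
    coroot := fun α ↦ ⟨coroot α.1.1, hcor α⟩
    e := fun α ↦ ⟨e α, heL α⟩
    f := fun α ↦ ⟨f α, hfL α⟩
    incl_lie_incl := fun t t' ↦ Subtype.ext
      (congrArg H.toSubmodule.subtype (trivial_lie_zero H H (t : H) (t' : H)))
    incl_lie_e := fun t α ↦ Subtype.ext (lie_eq_smul_of_mem_rootSpace (he α) (t : H))
    incl_lie_f := fun t α ↦ Subtype.ext (lie_eq_smul_of_mem_rootSpace (hf α) (t : H))
    sl2 := fun α ↦
      { h_ne_zero := fun h0 ↦ (hsl α).h_ne_zero ((hh α).trans (congrArg Subtype.val h0))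
        lie_e_f := Subtype.ext ((hsl α).lie_e_f.trans (hh α))
        lie_h_e_nsmul := Subtype.ext (by
          have := (hsl α).lie_h_e_nsmul
          rw [hh α] at this
          exact this)
        lie_h_f_nsmul := Subtype.ext (by
          have := (hsl α).lie_h_f_nsmul
          rw [hh α] at this
          exact this) }
    form := LinearMap.BilinForm.restrict (killingForm ℂ 𝔤) (levi R').toSubmodule
    form_lie := fun x y z ↦ LieModule.traceForm_apply_lie_apply ℂ 𝔤 𝔤 (x : 𝔤) y z
    form_symm := fun x y ↦ hsymm x y
    n := n
    v := v
    s := s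
    r := r
    r_pos := hr
    expand := fun z ↦ Subtype.ext (by
      conv_lhs => rw [← hexp z z.2, hE]
      simp only [AddMemClass.coe_add, AddSubmonoidClass.coe_finsetSum, SetLike.val_smul]
      rfl)
    sum_root_smul := fun α ↦ by
      conv_rhs => rw [hv ((r α : ℂ) • (⟨coroot α.1.1, hcor α⟩ : leviCartan R'))]
      refine Finset.sum_congr rfl fun j _ ↦ ?_
      congr 2
      change α.1.1 (v j : H) = LieModule.traceForm ℂ H 𝔤 ((r α : ℂ) • coroot α.1.1) (v j : H)
      rw [map_smul, LinearMap.smul_apply, smul_eq_mul, htrace]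
    root_sum_pos := fun α ↦ by
      refine ⟨r α * ((∑ γ : leviPosRoots b R', (rootSystem H).pairingIn ℤ γ.1 α.1 : ℤ) : ℝ),
        mul_pos (hr α) (by exact_mod_cast sum_pairingIn_pos α.2), ?_⟩
      rw [map_sum]
      push_cast
      rw [Finset.mul_sum]
      refine Finset.sum_congr rfl fun γ _ ↦ ?_
      change (rootSystem H).root α.1 ((r γ : ℂ) • coroot γ.1.1) = _
      rw [map_smul, ← apply_coroot_eq_pairingIn, smul_eq_mul, rootSystem_root_apply,
        LieModule.Weight.toLinear_apply, ← htrace α (coroot γ.1.1), ← htrace γ (coroot α.1.1),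
        LieModule.traceForm_comm]
      ring }, rfl, fun α ↦ ?_⟩
  exact Submodule.mem_iSup_of_mem (p := fun α : leviPosRoots b R' ↦
    (rootSpace H (α : H.root).1).toSubmodule) α (he α)

variable {b R'} in
theorem coe_mem_nPos {x : levi R'} (hx : x ∈ leviNPos b R') : (x : 𝔤) ∈ nPos b := by
  have hle : (⨆ α : leviPosRoots b R', (rootSpace H (α : H.root).1).toSubmodule) ≤ nPos b :=
    iSup_le fun α ↦ le_iSup (fun α : {α : H.root // b.IsPos α} ↦
      (rootSpace H (α : H.root).1).toSubmodule) ⟨α.1, α.2.2⟩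
  exact hle hx

end LeviStructure

/-! ### Cyclic submodules of tensor products of evaluation modules -/

section Tensor

variable {L : Type*} [LieRing L] [LieAlgebra ℂ L]

section Single

variable {T : Finset ℂ} {W : T → Type*} [∀ c, AddCommGroup (W c)] [∀ c, Module ℂ (W c)]

theorem pureTensor_update_add (y : ∀ c, W c) (c : T) (w w' : W c) :
    pureTensor (Function.update y c (w + w')) =
      pureTensor (Function.update y c w) + pureTensor (Function.update y c w') :=
  (PiTensorProduct.tprod ℂ).map_update_add y c w w'

theorem pureTensor_update_smul (y : ∀ c, W c) (c : T) (a : ℂ) (w : W c) :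
    pureTensor (Function.update y c (a • w)) = a • pureTensor (Function.update y c w) :=
  (PiTensorProduct.tprod ℂ).map_update_smul y c a w

theorem pureTensor_update_zero (y : ∀ c, W c) (c : T) :
    pureTensor (Function.update y c 0) = 0 := by
  simpa using pureTensor_update_smul y c 0 0

theorem evalTensor_induction {p : EvalTensor T W → Prop} (h : ∀ y, p (pureTensor y))
    (hadd : ∀ x y, p x → p y → p (x + y)) (hsmul : ∀ (a : ℂ) x, p x → p (a • x))
    (x : EvalTensor T W) : p x := by
  refine PiTensorProduct.induction_on x (fun a y ↦ hsmul a _ (h y)) (fun x y ↦ hadd x y)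

variable [∀ c, LieRingModule L (W c)] [∀ c, LieModule ℂ L (W c)]

theorem tmul_lie_pureTensor (p : ℂ[X]) (x : L) (y : ∀ c, W c) :
    ⁅(p ⊗ₜ x : Current L), pureTensor y⁆ =
      ∑ c : T, p.eval (c : ℂ) • pureTensor (Function.update y c ⁅x, y c⁆) := by
  change evalAction W L (p ⊗ₜ x) (pureTensor y) = _
  rw [evalAction_tmul, LinearMap.sum_apply]
  refine Finset.sum_congr rfl fun c _ ↦ ?_
  rw [LinearMap.smul_apply]
  congr 1
  refine (PiTensorProduct.map_tprod _ y).trans ?_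
  rw [pureTensor]
  congr 1
  funext d
  by_cases h : d = c
  · subst h
    simp
  · simp [Function.update_of_ne h]

/-- Interpolation at the points of `T` produces elements of the current algebra which act on a
single tensor factor. -/
theorem exists_lie_pureTensor_eq (c : T) (x : L) :
    ∃ u : Current L, ∀ y : ∀ c, W c,
      ⁅u, pureTensor y⁆ = pureTensor (Function.update y c ⁅x, y c⁆) := by
  refine ⟨Lagrange.basis T id c.1 ⊗ₜ x, fun y ↦ ?_⟩
  rw [tmul_lie_pureTensor, Finset.sum_eq_single c]
  · have := Lagrange.eval_basis_self (s := T) (v := id) (Set.injOn_id _) c.2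
    rw [id] at this
    rw [this, one_smul]
  · intro d _ hd
    have := Lagrange.eval_basis_of_ne (s := T) (v := id) (i := c.1) (j := d.1)
      (fun h ↦ hd (Subtype.ext h.symm)) d.2
    rw [id] at this
    rw [this, zero_smul]
  · simp

/-- A tensor product of simple modules evaluated at distinct points is generated by any pure tensor
of nonzero vectors. -/
theorem eq_top_of_pureTensor_mem (hW : ∀ c, LieModule.IsIrreducible ℂ L (W c)) (w : ∀ c, W c)
    (hw : ∀ c, w c ≠ 0) (N : LieSubmodule ℂ (Current L) (EvalTensor T W))
    (hN : pureTensor w ∈ N) : N = ⊤ := by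
  classical
  -- the factors of `w` are replaced by arbitrary vectors one after the other
  have key : ∀ (A : Finset T) (y : ∀ c, W c), (∀ c ∉ A, y c = w c) → pureTensor y ∈ N := by
    intro A
    induction A using Finset.induction_on with
    | empty =>
      intro y hy
      rwa [show y = w from funext fun c ↦ hy c (Finset.notMem_empty c)]
    | insert c A _ ih =>
      intro y hy
      let K : LieSubmodule ℂ L (W c) :=
        { carrier := {z | pureTensor (Function.update y c z) ∈ N}
          zero_mem' := by
            change pureTensor _ ∈ N
            rw [pureTensor_update_zero]
            exact zero_mem N
          add_mem' := fun {z z'} hz hz' ↦ by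
            change pureTensor _ ∈ N
            rw [pureTensor_update_add]
            exact add_mem hz hz'
          smul_mem' := fun a z hz ↦ by
            change pureTensor _ ∈ N
            rw [pureTensor_update_smul]
            exact N.smul_mem a hz
          lie_mem := fun {x z} hz ↦ by
            obtain ⟨u, hu⟩ := exists_lie_pureTensor_eq (W := W) c x
            have h := N.lie_mem (x := u) hz
            rw [hu, Function.update_idem, Function.update_self] at h
            exact h }
      have hwK : w c ∈ K := by
        refine ih _ fun d hd ↦ ?_
        by_cases hdc : d = c
        · subst hdc
          simp
        · rw [Function.update_of_ne hdc]
          exact hy d (by simp [hdc, hd])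
      have : Nontrivial K := ⟨⟨⟨w c, hwK⟩, 0, fun h ↦ hw c (congrArg Subtype.val h)⟩⟩
      have hK : K = ⊤ := LieSubmodule.eq_top_of_isIrreducible ℂ L (W c) K
      have hyK : y c ∈ K := hK ▸ LieSubmodule.mem_top _
      have h : pureTensor (Function.update y c (y c)) ∈ N := hyK
      rwa [Function.update_eq_self] at h
  refine eq_top_iff.mpr fun x _ ↦ ?_
  refine evalTensor_induction (fun y ↦ key Finset.univ y fun c hc ↦ ?_)
    (fun x y hx hy ↦ add_mem hx hy) (fun a x hx ↦ N.smul_mem a hx) x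
  exact absurd (Finset.mem_univ c) hc

end Single

variable {S T : Finset ℂ} {V : S → Type*} [∀ c, AddCommGroup (V c)] [∀ c, Module ℂ (V c)]
  {W : T → Type*} [∀ c, AddCommGroup (W c)] [∀ c, Module ℂ (W c)]
  (hTS : T ⊆ S)

open Classical in
/-- The family of vectors in the `V c`, `c ∈ S`, whose members are `g c (y c)` for `c ∈ T` and `v c`
otherwise. -/
def extendFamily (g : ∀ c : T, W c →ₗ[ℂ] V ⟨c.1, hTS c.2⟩) (v : ∀ c, V c) (y : ∀ c, W c) :
    ∀ c, V c := fun c ↦ if h : c.1 ∈ T then g ⟨c.1, h⟩ (y ⟨c.1, h⟩) else v c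

variable (g : ∀ c : T, W c →ₗ[ℂ] V ⟨c.1, hTS c.2⟩) (v : ∀ c, V c)

theorem extendFamily_of_mem (y : ∀ c, W c) (c : T) :
    extendFamily hTS g v y ⟨c.1, hTS c.2⟩ = g c (y c) := by
  simp [extendFamily]

theorem extendFamily_of_notMem (y : ∀ c, W c) {c : S} (hc : c.1 ∉ T) :
    extendFamily hTS g v y c = v c := by
  simp [extendFamily, hc]

theorem extendFamily_update [DecidableEq T] [DecidableEq S] (y : ∀ c, W c) (c : T) (w : W c) :
    extendFamily hTS g v (Function.update y c w) =
      Function.update (extendFamily hTS g v y) ⟨c.1, hTS c.2⟩ (g c w) := by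
  funext d
  by_cases hd : d.1 ∈ T
  · by_cases hdc : d.1 = c.1
    · obtain rfl : d = ⟨c.1, hTS c.2⟩ := Subtype.ext hdc
      rw [extendFamily_of_mem, Function.update_self, Function.update_self]
    · have h1 : (⟨d.1, hd⟩ : T) ≠ c := fun h ↦ hdc (congrArg Subtype.val h)
      rw [Function.update_of_ne (fun h ↦ hdc (congrArg Subtype.val h))]
      simp [extendFamily, hd, Function.update_of_ne h1]
  · rw [Function.update_of_ne (by rintro rfl; exact hd c.2), extendFamily_of_notMem _ _ _ _ hd,
      extendFamily_of_notMem _ _ _ _ hd]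

/-- The linear map `⨂_{c ∈ T} W c → ⨂_{c ∈ S} V c` which applies `g c` to the factors in `T` and
inserts the vectors `v c` in the other factors. -/
def extendTensor : EvalTensor T W →ₗ[ℂ] EvalTensor S V :=
  PiTensorProduct.lift
    { toFun := fun y ↦ PiTensorProduct.tprod ℂ (extendFamily hTS g v y)
      map_update_add' := fun y c w w' ↦ by
        classical
        rw [extendFamily_update, extendFamily_update, extendFamily_update, map_add]
        exact (PiTensorProduct.tprod ℂ (s := V)).map_update_add _ _ _ _
      map_update_smul' := fun y c a w ↦ by
        classical
        rw [extendFamily_update, extendFamily_update, map_smul]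
        exact (PiTensorProduct.tprod ℂ (s := V)).map_update_smul _ _ _ _ }

theorem extendTensor_pureTensor (y : ∀ c, W c) :
    extendTensor hTS g v (pureTensor y) = pureTensor (extendFamily hTS g v y) :=
  PiTensorProduct.lift.tprod y

/-- A left inverse of `extendTensor` is built from left inverses of the maps `g c` and from
functionals with value one on the vectors `v c`. -/
theorem extendTensor_injective (hg : ∀ c, Function.Injective (g c)) (hv : ∀ c, v c ≠ 0) :
    Function.Injective (extendTensor hTS g v) := by
  classical
  choose r hr using fun c ↦ (g c).exists_leftInverse_of_injective
    (LinearMap.ker_eq_bot.mpr (hg c))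
  have hr' : ∀ c x, r c (g c x) = x := fun c ↦ LinearMap.congr_fun (hr c)
  choose ξ hξ using fun c ↦ Module.Projective.exists_dual_eq_one ℂ (hv c)
  let m (y : ∀ c, V c) : ℂ := ∏ c : S, if c.1 ∈ T then 1 else ξ c (y c)
  let k (y : ∀ c, V c) : ∀ c, W c := fun c ↦ r c (y ⟨c.1, hTS c.2⟩)
  have hm_of_mem : ∀ [DecidableEq S] y (d : S) (w : V d), d.1 ∈ T →
      m (Function.update y d w) = m y := by
    intro _ y d w hd
    refine Finset.prod_congr rfl fun c _ ↦ ?_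
    split_ifs with hc
    · rfl
    · rw [Function.update_of_ne (by rintro rfl; exact hc hd)]
  have hm_of_notMem : ∀ [DecidableEq S] y (d : S) (w : V d), d.1 ∉ T → m (Function.update y d w) =
      ξ d w * ∏ c ∈ Finset.univ.erase d, if c.1 ∈ T then 1 else ξ c (y c) := by
    intro _ y d w hd
    simp only [m]
    rw [← Finset.mul_prod_erase _ _ (Finset.mem_univ d), if_neg hd, Function.update_self]
    congr 1
    refine Finset.prod_congr rfl fun c hc ↦ ?_
    rw [Function.update_of_ne (Finset.ne_of_mem_erase hc)]
  have hk_of_mem : ∀ [DecidableEq S] y (c : T) (w : V ⟨c.1, hTS c.2⟩),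
      k (Function.update y ⟨c.1, hTS c.2⟩ w) = Function.update (k y) c (r c w) := by
    intro _ y c w
    funext d
    by_cases hd : d = c
    · subst hd
      simp [k]
    · have : (⟨d.1, hTS d.2⟩ : S) ≠ ⟨c.1, hTS c.2⟩ := fun h ↦
        hd (Subtype.ext (congrArg Subtype.val h :))
      simp [k, Function.update_of_ne hd, Function.update_of_ne this]
  have hk_of_notMem : ∀ [DecidableEq S] y (d : S) (w : V d), d.1 ∉ T →
      k (Function.update y d w) = k y := by
    intro _ y d w hd
    funext c
    simp only [k]
    rw [Function.update_of_ne (by rintro rfl; exact hd c.2)]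
  -- the left inverse contracts the factors outside `T` with `ξ` and applies `r` to the others
  let ρ : MultilinearMap ℂ V (⨂[ℂ] c, W c) :=
    { toFun := fun y ↦ m y • PiTensorProduct.tprod ℂ (k y)
      map_update_add' := fun y d w w' ↦ by
        by_cases hd : d.1 ∈ T
        · rw [hm_of_mem _ _ _ hd, hm_of_mem _ _ _ hd, hm_of_mem _ _ _ hd,
            hk_of_mem y ⟨d.1, hd⟩, hk_of_mem y ⟨d.1, hd⟩, hk_of_mem y ⟨d.1, hd⟩, map_add,
            MultilinearMap.map_update_add, smul_add]
        · rw [hm_of_notMem _ _ _ hd, hm_of_notMem _ _ _ hd, hm_of_notMem _ _ _ hd,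
            hk_of_notMem _ _ _ hd, hk_of_notMem _ _ _ hd, hk_of_notMem _ _ _ hd, map_add, add_mul,
            add_smul]
      map_update_smul' := fun y d a w ↦ by
        by_cases hd : d.1 ∈ T
        · rw [hm_of_mem _ _ _ hd, hm_of_mem _ _ _ hd, hk_of_mem y ⟨d.1, hd⟩,
            hk_of_mem y ⟨d.1, hd⟩, map_smul, MultilinearMap.map_update_smul, smul_comm]
        · rw [hm_of_notMem _ _ _ hd, hm_of_notMem _ _ _ hd, hk_of_notMem _ _ _ hd,
            hk_of_notMem _ _ _ hd, map_smul, smul_eq_mul, mul_assoc, mul_smul] }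
  have hρ : ∀ x, PiTensorProduct.lift ρ (extendTensor hTS g v x) = x := by
    refine evalTensor_induction (fun y ↦ ?_) (fun x y hx hy ↦ ?_) (fun a x hx ↦ ?_)
    · rw [extendTensor_pureTensor]
      refine (PiTensorProduct.lift.tprod _).trans ?_
      change m _ • PiTensorProduct.tprod ℂ (k _) = _
      have hm1 : m (extendFamily hTS g v y) = 1 := by
        refine Finset.prod_eq_one fun c _ ↦ ?_
        split_ifs with hc
        · rfl
        · rw [extendFamily_of_notMem _ _ _ _ hc, hξ]
      have hk1 : k (extendFamily hTS g v y) = y := by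
        funext c
        simp only [k]
        rw [extendFamily_of_mem, hr']
      rw [hm1, hk1, one_smul]
      rfl
    · rw [map_add]
      exact (map_add _ _ _).trans (by rw [hx, hy]; rfl)
    · rw [map_smul]
      exact (map_smul _ _ _).trans (by rw [hx]; rfl)
  exact Function.LeftInverse.injective hρ

variable [∀ c, LieRingModule L (V c)] [∀ c, LieModule ℂ L (V c)]
  [∀ c, LieRingModule L (W c)] [∀ c, LieModule ℂ L (W c)]

/-- The tensor product of simple `L`-modules `W c`, evaluated at the points `c ∈ T`, is isomorphic
to the cyclic submodule generated by a pure tensor `⊗ v c` of `⨂_{c ∈ S} V c`, provided each `W c`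
embeds into `V c` as a submodule containing `v c`, and `L` kills the vectors `v c` with `c ∉ T`. -/
theorem nonempty_equiv_cyclic (g : ∀ c : T, W c →ₗ⁅ℂ, L⁆ V ⟨c.1, hTS c.2⟩)
    (hW : ∀ c, LieModule.IsIrreducible ℂ L (W c)) (hg : ∀ c, Function.Injective (g c))
    (w : ∀ c, W c) (hw : ∀ c, g c (w c) = v ⟨c.1, hTS c.2⟩) (hv : ∀ c, v c ≠ 0)
    (htriv : ∀ c : S, c.1 ∉ T → ∀ x : L, ⁅x, v c⁆ = 0) :
    Nonempty (EvalTensor T W ≃ₗ⁅ℂ, Current L⁆ cyclic (Current L) (pureTensor v)) := by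
  classical
  let g' : ∀ c : T, W c →ₗ[ℂ] V ⟨c.1, hTS c.2⟩ := fun c ↦ (g c).toLinearMap
  have hlie : ∀ (u : Current L) (x : EvalTensor T W),
      extendTensor hTS g' v ⁅u, x⁆ = ⁅u, extendTensor hTS g' v x⁆ := by
    intro u x
    induction u using TensorProduct.induction_on with
    | zero =>
      have h1 : ⁅(0 : Current L), x⁆ = 0 := zero_lie x
      have h2 : ⁅(0 : Current L), extendTensor hTS g' v x⁆ = 0 := zero_lie _
      rw [h1, h2, map_zero]
    | add u₁ u₂ h₁ h₂ =>
      have h3 : ⁅(u₁ + u₂ : Current L), x⁆ = ⁅u₁, x⁆ + ⁅u₂, x⁆ := add_lie _ _ _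
      have h4 : ⁅(u₁ + u₂ : Current L), extendTensor hTS g' v x⁆ =
          ⁅u₁, extendTensor hTS g' v x⁆ + ⁅u₂, extendTensor hTS g' v x⁆ := add_lie _ _ _
      rw [h3, h4, map_add, h₁, h₂]
    | tmul q z =>
      refine evalTensor_induction (p := fun x ↦ extendTensor hTS g' v ⁅(q ⊗ₜ z : Current L), x⁆ =
        ⁅(q ⊗ₜ z : Current L), extendTensor hTS g' v x⁆) (fun y ↦ ?_)
        (fun x y hx hy ↦ ?_) (fun a x hx ↦ ?_) x
      · rw [tmul_lie_pureTensor, extendTensor_pureTensor, tmul_lie_pureTensor, map_sum]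
        refine Fintype.sum_of_injective (fun c : T ↦ (⟨c.1, hTS c.2⟩ : S))
          (fun c d h ↦ Subtype.ext (congrArg Subtype.val h :)) _ _ (fun c hc ↦ ?_) (fun c ↦ ?_)
        · have hc' : c.1 ∉ T := fun h ↦ hc ⟨⟨c.1, h⟩, rfl⟩
          rw [extendFamily_of_notMem _ _ _ _ hc', htriv c hc', pureTensor_update_zero, smul_zero]
        · rw [map_smul, extendTensor_pureTensor, extendFamily_update, extendFamily_of_mem]
          change _ = q.eval c.1 • pureTensor (Function.update _ _ ⁅z, g c (y c)⁆)
          rw [← LieModuleHom.map_lie]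
          rfl
      · rw [lie_add, map_add, map_add, lie_add, hx, hy]
      · rw [lie_smul, map_smul, map_smul, lie_smul, hx]
  let G : EvalTensor T W →ₗ⁅ℂ, Current L⁆ EvalTensor S V :=
    { extendTensor hTS g' v with map_lie' := fun {u x} ↦ hlie u x }
  have hGinj : Function.Injective G := extendTensor_injective hTS g' v hg hv
  have hw0 : ∀ c, w c ≠ 0 := fun c h0 ↦ hv ⟨c.1, hTS c.2⟩ (by rw [← hw, h0, map_zero])
  have hGw : G (pureTensor w) = pureTensor v := by
    refine (extendTensor_pureTensor hTS g' v w).trans (congrArg _ (funext fun c ↦ ?_))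
    by_cases hc : c.1 ∈ T
    · exact (extendFamily_of_mem hTS g' v w ⟨c.1, hc⟩).trans (hw ⟨c.1, hc⟩)
    · exact extendFamily_of_notMem hTS g' v w hc
  have hmem : ∀ x, G x ∈ cyclic (Current L) (pureTensor v) := by
    intro x
    have htop : (cyclic (Current L) (pureTensor v)).comap G = ⊤ :=
      eq_top_of_pureTensor_mem hW w hw0 _ (by
        rw [LieSubmodule.mem_comap, hGw]
        exact LieSubmodule.subset_lieSpan rfl)
    have : x ∈ (cyclic (Current L) (pureTensor v)).comap G := htop ▸ LieSubmodule.mem_top x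
    exact LieSubmodule.mem_comap.mp this
  have hle : cyclic (Current L) (pureTensor v) ≤ G.range := by
    rw [LieSubmodule.lieSpan_le]
    rintro _ rfl
    exact ⟨pureTensor w, hGw⟩
  let G' : EvalTensor T W →ₗ⁅ℂ, Current L⁆ cyclic (Current L) (pureTensor v) :=
    { G.toLinearMap.codRestrict (cyclic (Current L) (pureTensor v)).toSubmodule hmem with
      map_lie' := fun {u x} ↦ Subtype.ext (G.map_lie u x) }
  have hG' : Function.Bijective G' := by
    refine ⟨fun x y h ↦ hGinj (congrArg Subtype.val h), fun x ↦ ?_⟩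
    obtain ⟨y, hy⟩ := (LieModuleHom.mem_range G x.1).mp (hle x.2)
    exact ⟨y, Subtype.ext hy⟩
  exact ⟨{ LinearEquiv.ofBijective G'.toLinearMap hG' with map_lie' := G'.map_lie _ _ }⟩

end Tensor

/-! ### Highest weight vectors restricted to the Levi subalgebra -/

section Restriction

/-- A highest weight vector of weight zero in a finite-dimensional module is invariant. -/
theorem TriangularData.IsHighest.lie_eq_zero {𝔱 L Pos M : Type*} [AddCommGroup 𝔱] [Module ℂ 𝔱]
    [LieRing L] [LieAlgebra ℂ L] [Fintype Pos] {D : TriangularData 𝔱 L Pos} [AddCommGroup M]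
    [Module ℂ M] [LieRingModule L M] [LieModule ℂ L M] [FiniteDimensional ℂ M] {m : M}
    (hm : D.IsHighest 0 m) (x : L) : ⁅x, m⁆ = 0 := by
  refine (Submodule.mem_bot ℂ).mp (D.lie_mem_of_generators ⊥ m (fun t ↦ ?_) (fun α ↦ ?_)
    (fun α ↦ ?_) x)
  · rw [hm.incl_lie, LinearMap.zero_apply, zero_smul]
    exact zero_mem _
  · rw [hm.e_lie]
    exact zero_mem _
  · have P : (D.sl2 α).HasPrimitiveVectorWith m (((0 : ℕ) : ℂ)) :=
      ⟨hm.ne_zero, by rw [hm.incl_lie]; simp, hm.e_lie α⟩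
    have h := P.pow_toEnd_f_eq_zero_of_eq_nat rfl
    rw [zero_add, pow_one, LieModule.toEnd_apply_apply] at h
    rw [h]
    exact zero_mem _

variable {𝔤 : Type*} [LieRing 𝔤] [LieAlgebra ℂ 𝔤] [FiniteDimensional ℂ 𝔤] [LieAlgebra.IsSimple ℂ 𝔤]
  {H : LieSubalgebra ℂ 𝔤} [H.IsCartanSubalgebra] {b : (rootSystem H).Base} {R' : ClosedRootSet H}
  [Fintype (leviPosRoots b R')] {D : TriangularData (leviCartan R') (levi R') (leviPosRoots b R')}

theorem IsSimpleOfHighestWeight.isHighest {M : Type*} [AddCommGroup M] [Module ℂ M]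
    [LieRingModule (levi R') M] [LieModule ℂ (levi R') M] (hincl : D.incl = leviCartanIncl R')
    (he : ∀ α, D.e α ∈ leviNPos b R') {μ : Dual ℂ (leviCartan R')} {m : M}
    (hm : IsSimpleOfHighestWeight (leviCartanIncl R') (leviNPos b R') μ m) : D.IsHighest μ m :=
  ⟨hm.ne_zero, fun t ↦ by rw [hincl, hm.cartan_lie], fun α ↦ hm.nPos_lie _ (he α)⟩

theorem IsSimpleOfHighestWeight.isHighest_res {M : Type*} [AddCommGroup M] [Module ℂ M]
    [LieRingModule 𝔤 M] [LieModule ℂ 𝔤 M] (hincl : D.incl = leviCartanIncl R')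
    (he : ∀ α, D.e α ∈ leviNPos b R') {μ : Dual ℂ H} {m : M}
    (hm : IsSimpleOfHighestWeight H.toSubmodule.subtype (nPos b) μ m) :
    D.IsHighest (res R' μ) m :=
  ⟨hm.ne_zero, fun t ↦ by rw [hincl]; exact hm.cartan_lie t,
    fun α ↦ hm.nPos_lie _ (coe_mem_nPos (he α))⟩

end Restriction

end LeviCurrent

end

theorem mainTheorem5 {𝔤 : Type*} [LieRing 𝔤] [LieAlgebra ℂ 𝔤] [FiniteDimensional ℂ 𝔤]
    [LieAlgebra.IsSimple ℂ 𝔤] (H : LieSubalgebra ℂ 𝔤) [H.IsCartanSubalgebra]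
    (b : (LieAlgebra.IsKilling.rootSystem H).Base) (R' : LeviCurrent.ClosedRootSet H)
    (lam : LeviCurrent.dominantWeights b) :
    (LeviCurrent.GloballyAdmissible b R' lam →
      ∀ φ : LeviCurrent.WeightFun (LeviCurrent.resDominant b R' lam),
        ∃ ψ : LeviCurrent.WeightFun lam,
          LeviCurrent.resFun b R' lam ψ = φ ∧
          -- for all models `V c` of `V(ψ(c))` and `Va c` of `V^𝔞(φ(c))`, with highest weight vectors
          ∀ (V : ψ.1.support → Type*) [∀ c, AddCommGroup (V c)] [∀ c, Module ℂ (V c)]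
            [∀ c, LieRingModule 𝔤 (V c)] [∀ c, LieModule ℂ 𝔤 (V c)] (v : ∀ c, V c)
            (_ : ∀ c : ψ.1.support, LeviCurrent.IsSimpleOfHighestWeight
              H.toSubmodule.subtype (LeviCurrent.nPos b) (ψ.1 c).1 (v c))
            (Va : φ.1.support → Type*) [∀ c, AddCommGroup (Va c)] [∀ c, Module ℂ (Va c)]
            [∀ c, LieRingModule (LeviCurrent.levi R') (Va c)]
            [∀ c, LieModule ℂ (LeviCurrent.levi R') (Va c)] (va : ∀ c, Va c)
            (_ : ∀ c : φ.1.support, LeviCurrent.IsSimpleOfHighestWeight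
              (LeviCurrent.leviCartanIncl R') (LeviCurrent.leviNPos b R') (φ.1 c).1 (va c)),
            Nonempty (LeviCurrent.EvalTensor φ.1.support Va
              ≃ₗ⁅ℂ, LeviCurrent.Current (LeviCurrent.levi R')⁆
                LeviCurrent.cyclic (LeviCurrent.Current (LeviCurrent.levi R'))
                  (LeviCurrent.pureTensor v))) ∧
    (LeviCurrent.GloballyAdmissible b R' lam ↔
      Function.Surjective (LeviCurrent.resFun b R' lam)) := by
  refine ⟨fun hadm φ ↦ ?_, fun h ↦ h.surjective_resFun,
    LeviCurrent.globallyAdmissible_of_surjective⟩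
  obtain ⟨ψ, hψ⟩ := hadm.surjective_resFun φ
  refine ⟨ψ, hψ, ?_⟩
  intro V _ _ _ _ v hv Va _ _ _ _ va hva
  have : Fintype (LeviCurrent.leviPosRoots b R') := Fintype.ofFinite _
  obtain ⟨D, hincl, he⟩ := LeviCurrent.exists_triangularData b R'
  have hval : ∀ c : ℂ, (φ.1 c).1 = LeviCurrent.res R' (ψ.1 c).1 := fun c ↦ by
    rw [← hψ]
    rfl
  have hsupp : φ.1.support ⊆ ψ.1.support := by
    rw [← hψ]
    exact Finsupp.support_mapRange (hf := map_zero _)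
  have hV : ∀ c : ψ.1.support, D.IsHighest (LeviCurrent.res R' (ψ.1 c).1) (v c) := fun c ↦
    (hv c).isHighest_res hincl he
  have hVa : ∀ c : φ.1.support, D.IsHighest (LeviCurrent.res R' (ψ.1 c).1) (va c) := fun c ↦ by
    have := (hva c).isHighest hincl he
    rwa [hval] at this
  have := fun c ↦ (hv c).finiteDimensional
  have := fun c ↦ (hva c).finiteDimensional
  have hirr := fun c ↦ (hva c).simple
  choose g hg hgv using fun c : φ.1.support ↦
    (hVa c).exists_embedding (hV ⟨c.1, hsupp c.2⟩)
  refine LeviCurrent.nonempty_equiv_cyclic hsupp v g hirr hg va hgv (fun c ↦ (hv c).ne_zero) ?_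
  intro c hc x
  have h0 := hV c
  rw [← hval, Finsupp.notMem_support_iff.mp hc] at h0
  exact h0.lie_eq_zero x
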